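/- \textbf{Maximum principle for the concentration.} Let $d\in\{2,3\}$, let $\Omega\subset\mathbb R^d$ be a bounded Lipschitz domain, $g\in L^\infty(\Omega)^d$, $\kappa\in L^\infty(\Omega)$ with $\kappa\ge\kappa_1>0$ a.e., and let $k\ge 0$ and $D,K,\alpha,R>0$ be constants. Put $\mu(s)=e^{Rs}$ and, for $\ell>0$, let $\tilde\mu_\ell(s)=e^{R\ell}$ if $s>\ell$, $\tilde\mu_\ell(s)=e^{Rs}$ if $|s|\le\ell$, and $\tilde\mu_\ell(s)=e^{-R\ell}$ if $s<-\ell$. Let $H(\Omega)$ be the space of all $v\in L^2(\Omega)^d$ with $\nabla\cdot v=0$ in $\Omega$ and $v\cdot\nu=0$ on $\partial\Omega$ (weakly), and let $(\cdot,\cdot)$ be the inner product of $L^2(\Omega)$ or of $L^2(\Omega)^d$. Fix a sign $\sigma\in\{1,-1\}$ for the convection term. For $m=\tilde\mu_\ell$ or $m=\mu$, consider pairs $(c,u)$ with $c\in L^2(0,\infty;H^1(\Omega))$, $u\in L^2(0,\infty;H(\Omega))\cap L^2(0,\infty;L^p(\Omega)^d)$ for all $p\in[2,\infty)$ (with $p\le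 6$ if $d=3$), $\partial_t c\in L^r(0,T;(H^1(\Omega))^*)$ for all $T<\infty$, where $r=2$ if $d=2$ and $r=4/3$ if $d=3$, such that $c(0)=c_0$ in $L^2(\Omega)$ and, for a.e. $t>0$, \[ \Bigl(\tfrac{m(c)}{K}u,v\Bigr)+\bigl((1+\alpha c)g,v\bigr)=0\quad\forall v\in H(\Omega), \] \[ (1+k)\langle\partial_t c,\varphi\rangle+\sigma\,(c\,u,\nabla\varphi)+D(\nabla c,\nabla\varphi)+(\kappa c,\varphi)=0\quad\forall\varphi\in H^1(\Omega). \] (By Sobolev's embedding $c(t)u(t)\in L^2(\Omega)^d$ for a.e. $t$.) Such a pair is a weak solution of the $\ell$-approximate (truncated) problem if $m=\tilde\mu_\ell$ and $c\in L^\infty(0,\infty;L^2(\Omega))$, and a weak solution of the original problem if $m=\mu$ and $c\in L^\infty(0,\infty;L^\infty(\Omega))$. Suppose that $0\le c_0\le M_2$ a.e. in $\Omega$. Then: (1) For every $\ell>0$ and every weak solution $(c_\ell,u_\ell)$ of the $\ell$-approximate problem, $0\le c_\ell(t,x)\le M_2$ for a.e. $(t,x)\in(0,\infty)\times\Omega$.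 Consequently $e^{-RM_2}\le\tilde\mu_\ell(c_\ell)\le e^{RM_2}$ a.e. in $(0,\infty)\times\Omega$, with bounds independent of $\ell$. (2) If $(c_{\ell_n},u_{\ell_n})$ are weak solutions of the $\ell_n$-approximate problems with initial value $c_0$, where $\ell_n>0$ and $\ell_n\to\infty$, and if $c_{\ell_n}\to c$ in $L^2(0,T;L^2(\Omega))$ for every $T>0$, then $0\le c\le M_2$ a.e. in $(0,\infty)\times\Omega$. (3) Every weak solution $(c,u)$ of the original problem satisfies $0\le c\le M_2$ a.e. in $(0,\infty)\times\Omega$. -/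

import Mathlib

open MeasureTheory Set Filter Topology
open scoped ENNReal NNReal ContDiff RealInnerProductSpace

namespace DarcyTransport

/-- The Euclidean space `ℝ^d`. -/
abbrev E (d : ℕ) : Type := EuclideanSpace ℝ (Fin d)

/-- Lebesgue measure on `Ω`. -/
noncomputable abbrev vol {d : ℕ} (Ω : Set (E d)) : Measure (E d) := volume.restrict Ω

/-- Lebesgue measure on the space-time cylinder `(0,∞) × Ω`. -/
noncomputable abbrev cyl {d : ℕ} (Ω : Set (E d)) : Measure (ℝ × E d) :=
  (volume.restrict (Ioi (0 : ℝ))).prod (vol Ω)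

/-- Lebesgue measure on the space-time cylinder `(0,T) × Ω`. -/
noncomputable abbrev cylT {d : ℕ} (T : ℝ) (Ω : Set (E d)) : Measure (ℝ × E d) :=
  (volume.restrict (Ioo (0 : ℝ) T)).prod (vol Ω)

/-- A bounded domain (nonempty, open, connected) with Lipschitz boundary: near each boundary
point, and for a suitable unit vector `n`, it is the region strictly below the graph, in
direction `n`, of a Lipschitz function of the component orthogonal to `n`. -/
def IsBoundedLipschitzDomain {d : ℕ} (Ω : Set (E d)) : Prop :=
  IsOpen Ω ∧ IsConnected Ω ∧ Bornology.IsBounded Ω ∧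
    ∀ x ∈ frontier Ω, ∃ n : E d, ‖n‖ = 1 ∧ ∃ δ : ℝ, 0 < δ ∧ ∃ (L : ℝ≥0) (γ : E d → ℝ),
      LipschitzWith L γ ∧
        ∀ y ∈ Metric.ball x δ, (y ∈ Ω ↔ ⟪n, y⟫ < γ (y - ⟪n, y⟫ • n))

/-- Test functions: the elements of `C_c^∞(Ω)`, extended by zero. -/
def IsTest {d : ℕ} (Ω : Set (E d)) (φ : E d → ℝ) : Prop :=
  ContDiff ℝ ∞ φ ∧ HasCompactSupport φ ∧ tsupport φ ⊆ Ω

/-- `L²(Ω)`. -/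
abbrev L2 {d : ℕ} (Ω : Set (E d)) : Type := Lp ℝ 2 (vol Ω)

/-- `L²(Ω)^d`. -/
abbrev L2vec {d : ℕ} (Ω : Set (E d)) : Type := Lp (E d) 2 (vol Ω)

/-- `g` is the weak gradient of `f` in `Ω` (tested in every direction `v`). -/
def HasWeakGrad {d : ℕ} (Ω : Set (E d)) (f : L2 Ω) (g : L2vec Ω) : Prop :=
  ∀ φ : E d → ℝ, IsTest Ω φ → ∀ v : E d,
    ∫ x in Ω, f x * fderiv ℝ φ x v = -∫ x in Ω, ⟪v, g x⟫ * φ x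

theorem IsTest.integrable_mul_fderiv {d : ℕ} {Ω : Set (E d)} {φ : E d → ℝ} (h : IsTest Ω φ)
    (f : L2 Ω) (v : E d) : Integrable (fun x => f x * fderiv ℝ φ x v) (vol Ω) := by
  have hc : Continuous (fun x => fderiv ℝ φ x v) :=
    (h.1.continuous_fderiv (by simp)).clm_apply continuous_const
  have hs : HasCompactSupport (fun x => fderiv ℝ φ x v) := h.2.1.fderiv_apply (𝕜 := ℝ) v
  exact MemLp.integrable_mul (p := 2) (q := 2) (Lp.memLp f) (hc.memLp_of_hasCompactSupport hs)

theorem IsTest.integrable_inner_mul {d : ℕ} {Ω : Set (E d)} {φ : E d → ℝ} (h : IsTest Ω φ)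
    (g : L2vec Ω) (v : E d) : Integrable (fun x => ⟪v, g x⟫ * φ x) (vol Ω) :=
  MemLp.integrable_mul (p := 2) (q := 2) ((Lp.memLp g).const_inner v)
    (h.1.continuous.memLp_of_hasCompactSupport h.2.1)

theorem HasWeakGrad.add {d : ℕ} {Ω : Set (E d)} {f f' : L2 Ω} {g g' : L2vec Ω}
    (h : HasWeakGrad Ω f g) (h' : HasWeakGrad Ω f' g') : HasWeakGrad Ω (f + f') (g + g') := by
  intro φ hφ v
  have e1 : ∫ x in Ω, (f + f') x * fderiv ℝ φ x v =
      ∫ x in Ω, (f x * fderiv ℝ φ x v + f' x * fderiv ℝ φ x v) := by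
    refine integral_congr_ae ?_
    filter_upwards [Lp.coeFn_add f f'] with x hx
    rw [hx, Pi.add_apply, add_mul]
  have e2 : ∫ x in Ω, ⟪v, (g + g') x⟫ * φ x =
      ∫ x in Ω, (⟪v, g x⟫ * φ x + ⟪v, g' x⟫ * φ x) := by
    refine integral_congr_ae ?_
    filter_upwards [Lp.coeFn_add g g'] with x hx
    rw [hx, Pi.add_apply, inner_add_right, add_mul]
  rw [e1, e2, integral_add (hφ.integrable_mul_fderiv f v) (hφ.integrable_mul_fderiv f' v),
    integral_add (hφ.integrable_inner_mul g v) (hφ.integrable_inner_mul g' v), h φ hφ v,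
    h' φ hφ v]
  ring

theorem HasWeakGrad.smul {d : ℕ} {Ω : Set (E d)} {f : L2 Ω} {g : L2vec Ω} (a : ℝ)
    (h : HasWeakGrad Ω f g) : HasWeakGrad Ω (a • f) (a • g) := by
  intro φ hφ v
  have e1 : ∫ x in Ω, (a • f) x * fderiv ℝ φ x v = ∫ x in Ω, a * (f x * fderiv ℝ φ x v) := by
    refine integral_congr_ae ?_
    filter_upwards [Lp.coeFn_smul a f] with x hx
    rw [hx, Pi.smul_apply, smul_eq_mul, mul_assoc]
  have e2 : ∫ x in Ω, ⟪v, (a • g) x⟫ * φ x = ∫ x in Ω, a * (⟪v, g x⟫ * φ x) := by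
    refine integral_congr_ae ?_
    filter_upwards [Lp.coeFn_smul a g] with x hx
    rw [hx, Pi.smul_apply, real_inner_smul_right, mul_assoc]
  rw [e1, e2, integral_const_mul, integral_const_mul, h φ hφ v]
  ring

theorem HasWeakGrad.zero {d : ℕ} (Ω : Set (E d)) : HasWeakGrad Ω 0 0 := by
  intro φ hφ v
  have e1 : ∫ x in Ω, (0 : L2 Ω) x * fderiv ℝ φ x v = ∫ x in Ω, (0 : ℝ) := by
    refine integral_congr_ae ?_
    filter_upwards [Lp.coeFn_zero ℝ 2 (vol Ω)] with x hx
    rw [hx, Pi.zero_apply, zero_mul]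
  have e2 : ∫ x in Ω, ⟪v, (0 : L2vec Ω) x⟫ * φ x = ∫ x in Ω, (0 : ℝ) := by
    refine integral_congr_ae ?_
    filter_upwards [Lp.coeFn_zero (E d) 2 (vol Ω)] with x hx
    rw [hx, Pi.zero_apply, inner_zero_right, zero_mul]
  rw [e1, e2]
  simp

/-- The pairs `(f, ∇f)` in `L²(Ω) × L²(Ω)^d`, a subspace of this Hilbert space. -/
noncomputable def H1sub {d : ℕ} (Ω : Set (E d)) :
    Submodule ℝ (WithLp 2 (L2 Ω × L2vec Ω)) where
  carrier := {p | HasWeakGrad Ω p.fst p.snd}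
  add_mem' := fun h h' => HasWeakGrad.add h h'
  zero_mem' := HasWeakGrad.zero Ω
  smul_mem' := fun a _ h => HasWeakGrad.smul a h

/-- The Sobolev space `H¹(Ω)`, realised as the space of pairs `(f, ∇f)`, with the Hilbert norm
`(‖f‖² + ‖∇f‖²)^(1/2)`. -/
def H1 {d : ℕ} (Ω : Set (E d)) : Type := H1sub Ω

noncomputable instance H1.instNormedAddCommGroup {d : ℕ} (Ω : Set (E d)) :
    NormedAddCommGroup (H1 Ω) :=
  inferInstanceAs (NormedAddCommGroup (H1sub Ω))

noncomputable instance H1.instInnerProductSpace {d : ℕ} (Ω : Set (E d)) :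
    InnerProductSpace ℝ (H1 Ω) :=
  inferInstanceAs (InnerProductSpace ℝ (H1sub Ω))

/-- The underlying function of an element of `H¹(Ω)`. -/
noncomputable def H1.fn {d : ℕ} {Ω : Set (E d)} (φ : H1 Ω) : L2 Ω := φ.val.fst

/-- The weak gradient of an element of `H¹(Ω)`. -/
noncomputable def H1.grad {d : ℕ} {Ω : Set (E d)} (φ : H1 Ω) : L2vec Ω := φ.val.snd

/-- The dual space `(H¹(Ω))*`. -/
def H1dual {d : ℕ} (Ω : Set (E d)) : Type := StrongDual ℝ (H1 Ω)

noncomputable instance H1dual.instNormedAddCommGroup {d : ℕ} (Ω : Set (E d)) :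
    NormedAddCommGroup (H1dual Ω) :=
  inferInstanceAs (NormedAddCommGroup (StrongDual ℝ (H1 Ω)))

noncomputable instance H1dual.instNormedSpace {d : ℕ} (Ω : Set (E d)) :
    NormedSpace ℝ (H1dual Ω) :=
  inferInstanceAs (NormedSpace ℝ (StrongDual ℝ (H1 Ω)))

instance H1dual.instCompleteSpace {d : ℕ} (Ω : Set (E d)) : CompleteSpace (H1dual Ω) :=
  inferInstanceAs (CompleteSpace (StrongDual ℝ (H1 Ω)))

/-- The duality pairing `⟨w, φ⟩` between `(H¹(Ω))*` and `H¹(Ω)`. -/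
noncomputable def H1dual.pair {d : ℕ} {Ω : Set (E d)} (w : H1dual Ω) (φ : H1 Ω) : ℝ :=
  (show StrongDual ℝ (H1 Ω) from w) φ

/-- `q` is the weak divergence of `v` in `Ω`. -/
def HasWeakDiv {d : ℕ} (Ω : Set (E d)) (v : L2vec Ω) (q : L2 Ω) : Prop :=
  ∀ φ : E d → ℝ, IsTest Ω φ → ∫ x in Ω, fderiv ℝ φ x (v x) = -∫ x in Ω, q x * φ x

/-- The normal trace `v · ν` of a field `v` with weak divergence `q` vanishes on `∂Ω`; the trace
is the functional `φ ↦ (v, ∇φ) + (div v, φ)` on `H¹(Ω)` given by Green's formula. -/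
def HasZeroNormalTrace {d : ℕ} (Ω : Set (E d)) (v : L2vec Ω) (q : L2 Ω) : Prop :=
  ∀ φ : H1 Ω, (∫ x in Ω, ⟪v x, φ.grad x⟫) + ∫ x in Ω, q x * φ.fn x = 0

/-- The space `H₀(div; Ω)`. -/
def H0div {d : ℕ} (Ω : Set (E d)) : Set (L2vec Ω) :=
  {v | ∃ q : L2 Ω, HasWeakDiv Ω v q ∧ HasZeroNormalTrace Ω v q}

/-- The space `H(Ω)` of the divergence-free fields in `H₀(div; Ω)`. -/
def solenoidal {d : ℕ} (Ω : Set (E d)) : Set (L2vec Ω) :=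
  {v | v ∈ H0div Ω ∧ HasWeakDiv Ω v 0}

/-- The data of the model and the standing assumptions on them: the domain `Ω`, the gravity field
`g`, the reaction rate `κ` with its lower bound `κ₁`, the adsorption coefficient `k`, the
diffusion coefficient `D`, the permeability `K`, and the density and viscosity contrasts
`α`, `R`. -/
structure Medium (d : ℕ) where
  Ω : Set (E d)
  g : E d → E d
  κ : E d → ℝ
  κ₁ : ℝ
  k : ℝ
  D : ℝ
  K : ℝ
  α : ℝ
  R : ℝ
  domain : IsBoundedLipschitzDomain Ω
  g_mem : MemLp g ∞ (vol Ω)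
  κ_mem : MemLp κ ∞ (vol Ω)
  κ₁_pos : 0 < κ₁
  κ_ge : ∀ᵐ x ∂(vol Ω), κ₁ ≤ κ x
  k_nonneg : 0 ≤ k
  D_pos : 0 < D
  K_pos : 0 < K
  α_pos : 0 < α
  R_pos : 0 < R

/-- The viscosity `μ(s) = exp (R s)`. -/
noncomputable def viscosity (R s : ℝ) : ℝ := Real.exp (R * s)

/-- The viscosity truncated at level `ℓ`. -/
noncomputable def truncViscosity (R ℓ s : ℝ) : ℝ :=
  if ℓ < s then Real.exp (R * ℓ) else if s < -ℓ then Real.exp (-(R * ℓ)) else Real.exp (R * s)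

/-- The time-integrability exponent of `∂c/∂t`: `2` if `d = 2` and `4/3` if `d = 3`. -/
noncomputable def timeExponent (d : ℕ) : ℝ≥0∞ := if d = 2 then 2 else 4 / 3

/-- `W` is the weak time derivative on `(0,∞)` of `C`, where `C(t)` is regarded as the element
`φ ↦ (C(t), φ)` of `(H¹(Ω))*`. -/
def HasWeakTimeDeriv {d : ℕ} {Ω : Set (E d)} (C : ℝ → H1 Ω) (W : ℝ → H1dual Ω) :
    Prop :=
  ∀ η : ℝ → ℝ, ContDiff ℝ ∞ η → HasCompactSupport η → tsupport η ⊆ Ioi 0 → ∀ φ : H1 Ω,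
    ∫ t in Ioi (0 : ℝ), deriv η t * ∫ x in Ω, (C t).fn x * φ.fn x =
      -∫ t in Ioi (0 : ℝ), η t * (W t).pair φ

/-- `(c, u)` solves weakly the Darcy–transport system with viscosity law `m` and initial
concentration `c₀`; `C` is `c` as an `H¹(Ω)`-valued function, `W` is its time derivative.
The number `s = ±1` is the sign of the convection term `(c u, ∇φ)`. -/
structure IsWeakSolutionWith {d : ℕ} (P : Medium d) (s : ℝ) (m : ℝ → ℝ) (c₀ : E d → ℝ)
    (c : ℝ → E d → ℝ) (u : ℝ → L2vec P.Ω) (C : ℝ → H1 P.Ω)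
    (W : ℝ → H1dual P.Ω) : Prop where
  /-- `c` is measurable on `(0,∞) × Ω` and `C` represents it. -/
  meas : AEStronglyMeasurable (Function.uncurry c) (cyl P.Ω)
  repr : ∀ᵐ t ∂(volume.restrict (Ioi (0 : ℝ))), ∀ᵐ x ∂(vol P.Ω), (C t).fn x = c t x
  /-- `c ∈ L²(0,∞; H¹(Ω))`. -/
  c_mem : MemLp C 2 (volume.restrict (Ioi (0 : ℝ)))
  /-- `u ∈ L²(0,∞; H(Ω))`. -/
  u_mem : MemLp u 2 (volume.restrict (Ioi (0 : ℝ)))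
  u_sol : ∀ᵐ t ∂(volume.restrict (Ioi (0 : ℝ))), u t ∈ solenoidal P.Ω
  /-- `u ∈ L²(0,∞; L^p(Ω)^d)`, for all finite `p ≥ 2`, with `p ≤ 6` if `d = 3`. -/
  u_Lp : ∀ p : ℝ, 2 ≤ p → (d = 3 → p ≤ 6) →
    ∫⁻ t in Ioi (0 : ℝ), (eLpNorm (u t) (ENNReal.ofReal p) (vol P.Ω)) ^ 2 < (⊤ : ℝ≥0∞)
  /-- `∂c/∂t = W ∈ L^r(0,T; (H¹(Ω))*)` for all finite `T`. -/
  deriv_eq : HasWeakTimeDeriv C W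
  deriv_mem : ∀ T : ℝ, 0 < T → MemLp W (timeExponent d) (volume.restrict (Ioo 0 T))
  /-- `c(0) = c₀` in `L²(Ω)`: `c(t) → c₀` in `L²(Ω)` as `t → 0+` off a null set of times. -/
  initial : Tendsto (fun t => eLpNorm (c t - c₀) 2 (vol P.Ω)) (𝓝[>] 0 ⊓ ae volume) (𝓝 0)
  /-- The Darcy equation. -/
  darcy : ∀ᵐ t ∂(volume.restrict (Ioi (0 : ℝ))), ∀ v ∈ solenoidal P.Ω,
    (∫ x in P.Ω, ⟪(m (c t x) / P.K) • u t x, v x⟫) +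
      ∫ x in P.Ω, ⟪(1 + P.α * c t x) • P.g x, v x⟫ = 0
  /-- `c(t) u(t) ∈ L²(Ω)^d`, so that the inner product `(c u, ∇φ)` below is one of `L²(Ω)^d`;
  this follows from the regularity above by Sobolev's embedding. -/
  flux_mem : ∀ᵐ t ∂(volume.restrict (Ioi (0 : ℝ))), MemLp (fun x => c t x • u t x) 2 (vol P.Ω)
  /-- The transport equation. -/
  transport : ∀ᵐ t ∂(volume.restrict (Ioi (0 : ℝ))), ∀ φ : H1 P.Ω,
    (1 + P.k) * (W t).pair φ + s * (∫ x in P.Ω, ⟪c t x • u t x, φ.grad x⟫) +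
      P.D * (∫ x in P.Ω, ⟪(C t).grad x, φ.grad x⟫) + ∫ x in P.Ω, P.κ x * c t x * φ.fn x = 0

/-- Weak solutions of the `ℓ`-approximate problem (truncated viscosity), with
`c ∈ L^∞(0,∞; L²(Ω))`. -/
def IsTruncatedWeakSolution {d : ℕ} (P : Medium d) (s ℓ : ℝ) (c₀ : E d → ℝ) (c : ℝ → E d → ℝ)
    (u : ℝ → L2vec P.Ω) : Prop :=
  (∃ B : ℝ≥0, ∀ᵐ t ∂(volume.restrict (Ioi (0 : ℝ))), eLpNorm (c t) 2 (vol P.Ω) ≤ B) ∧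
    ∃ C W, IsWeakSolutionWith P s (truncViscosity P.R ℓ) c₀ c u C W

/-- Weak solutions of the original problem (viscosity `exp (R c)`), with
`c ∈ L^∞(0,∞; L^∞(Ω))`. -/
def IsWeakSolution {d : ℕ} (P : Medium d) (s : ℝ) (c₀ : E d → ℝ) (c : ℝ → E d → ℝ)
    (u : ℝ → L2vec P.Ω) : Prop :=
  (∃ B : ℝ≥0, ∀ᵐ t ∂(volume.restrict (Ioi (0 : ℝ))), eLpNorm (c t) ∞ (vol P.Ω) ≤ B) ∧
    ∃ C W, IsWeakSolutionWith P s (viscosity P.R) c₀ c u C W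

end DarcyTransport

/-!
The formal proof of the maximum principle tests the transport equation with `b(c)`, where `b = B'`
is the derivative of a convex function `B` vanishing exactly on one of the half-lines `s ≤ M₂` and
`0 ≤ s`. The diffusion and reaction terms have a sign, the convection term is `∫ u · ∇H(c) = 0`
with `H' = s b'(s)`, and so `∫ B(c(t))` is nonincreasing; it vanishes initially, hence always. The
Darcy equation, and with it the viscosity law, plays no role.

The difficulty is that `∂c/∂t` lies only in `L^{4/3}(0,T; (H¹)*)` if `d = 3`, while `b(c)` lies in
`L²(0,T; H¹)`, so that the chain rule `d/dt ∫ B(c) = ⟨∂c/∂t, b(c)⟩` is not available. It is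
replaced by an inequality for finite increments. For almost all times `t < t'`, convexity gives
`∫ B(c(t')) - ∫ B(c(t)) ≤ (c(t') - c(t), b(c(t'))) = ∫_t^{t'} ⟨∂c/∂t(τ), b(c(t'))⟩ dτ`
(`IsPenalty.sub_le`, `HasWeakTimeDeriv.exists_sub_eq_integral`). In the last integrand the
convection term is rewritten, by the product rule and `div u = 0`, as
`∫ b(c(t')) u(τ) · ∇(c(τ) - c(t'))` up to sign: the function `b` is bounded, so only the `L²` norms
of `u(τ)` and of `∇c(τ) - ∇c(t')` enter (`abs_integral_convection_le`). Together with the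
monotonicity of the other terms, the integrand is at most a constant times
`(‖u(τ)‖ + ‖c(t')‖) ‖c(τ) - c(t')‖`, with `H¹` norms of `c` (`pair_penalty_le`). Averaged in time
over increments of length `h`, this tends to zero with `h` by the continuity of translations in
`L²(ℝ; H¹)`, so that `∫ B(c)` is nonincreasing off a null set (`le_of_increment_le_lintegral`).

The products and compositions with elements of `H¹(Ω)` rest on a chain rule for weak derivatives,
proved by mollification (`HasWeakDirDeriv.comp`).
-/

namespace DarcyTransport

open scoped Convolution

/-! ### Translations and mollifications in `L^p` -/

/-- Translations act continuously on `L^p`, for `p < ∞`. -/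
theorem tendsto_eLpNorm_translate_sub {G X : Type*} [NormedAddCommGroup G] [NormedSpace ℝ G]
    [FiniteDimensional ℝ G] [MeasurableSpace G] [BorelSpace G] [NormedAddCommGroup X]
    {μ : Measure G} [μ.IsAddHaarMeasure] {p : ℝ≥0∞} (hp : 1 ≤ p) (hp' : p ≠ ⊤) {f : G → X}
    (hf : MemLp f p μ) :
    Tendsto (fun y => eLpNorm (fun x => f (y + x) - f x) p μ) (𝓝 0) (𝓝 0) := by
  have : Fact (1 ≤ p) := ⟨hp⟩
  have : Fact (p ≠ ⊤) := ⟨hp'⟩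
  have hc : Continuous fun y : G => (DomAddAct.mk y) +ᵥ (hf.toLp f) := by
    have : Continuous (DomAddAct.mk : G → Gᵈᵃᵃ) := DomAddAct.continuous_mk
    exact this.vadd continuous_const
  have h0 : Tendsto (fun y : G => edist ((DomAddAct.mk y) +ᵥ (hf.toLp f)) (hf.toLp f)) (𝓝 0)
      (𝓝 0) := by
    have := (hc.edist continuous_const : Continuous fun y : G =>
      edist ((DomAddAct.mk y) +ᵥ (hf.toLp f)) (hf.toLp f)).tendsto 0
    simpa using this
  refine h0.congr fun y => ?_
  rw [DomAddAct.mk_vadd_toLp, Lp.edist_toLp_toLp]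
  rfl

/-- Mollifications of an integrable function converge to it in `L¹`, because the error at scale `r`
is an average of the translation errors `‖f(· - y) - f‖` over `|y| ≤ r`. -/
theorem tendsto_lintegral_enorm_convolution_sub {G X : Type*} [NormedAddCommGroup G]
    [NormedSpace ℝ G] [FiniteDimensional ℝ G] [MeasurableSpace G] [BorelSpace G]
    [NormedAddCommGroup X] [NormedSpace ℝ X] [CompleteSpace X]
    {μ : Measure G} [μ.IsAddHaarMeasure] {f : G → X} (hf : Integrable f μ)
    {ρ : ℕ → ContDiffBump (0 : G)} (hρ : Tendsto (fun n => (ρ n).rOut) atTop (𝓝 0)) :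
    Tendsto (fun n => ∫⁻ x, ‖((ρ n).normed μ ⋆[ContinuousLinearMap.lsmul ℝ ℝ, μ] f) x - f x‖ₑ ∂μ)
      atTop (𝓝 0) := by
  rw [ENNReal.tendsto_nhds_zero]
  intro ε hε
  have ht := tendsto_eLpNorm_translate_sub le_rfl ENNReal.one_ne_top (memLp_one_iff_integrable.2 hf)
  rw [ENNReal.tendsto_nhds_zero] at ht
  obtain ⟨δ, hδ, hball⟩ := Metric.eventually_nhds_iff.1 (ht ε hε)
  filter_upwards [(tendsto_order.1 hρ).2 δ hδ] with n hn
  set r := (ρ n).normed μ with hr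
  have hrc : Continuous r := (ρ n).continuous_normed
  have hr0 : ∀ y, 0 ≤ r y := (ρ n).nonneg_normed
  have hri : Integrable r μ := (ρ n).integrable_normed
  have hr1 : ∫⁻ y, ‖r y‖ₑ ∂μ = 1 := by
    rw [← ofReal_integral_norm_eq_lintegral_enorm hri]
    simp_rw [Real.norm_of_nonneg (hr0 _)]
    rw [(ρ n).integral_normed, ENNReal.ofReal_one]
  have key : ∀ x, (r ⋆[ContinuousLinearMap.lsmul ℝ ℝ, μ] f) x - f x
      = ∫ y, r y • (f (-y + x) - f x) ∂μ := by
    intro x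
    have i1 : Integrable (fun y => r y • f (x - y)) μ := by
      have := (ρ n).hasCompactSupport_normed (μ := μ) |>.convolutionExists_left
        (ContinuousLinearMap.lsmul ℝ ℝ) hrc hf.locallyIntegrable x
      exact this
    simp_rw [smul_sub, neg_add_eq_sub]
    rw [integral_sub i1 (hri.smul_const _), integral_smul_const, (ρ n).integral_normed, one_smul]
    rfl
  have hmeas : AEMeasurable (Function.uncurry fun x y => ‖r y • (f (-y + x) - f x)‖ₑ)
      (μ.prod μ) := by
    have m1 : AEStronglyMeasurable (fun z : G × G => f (z.1 - z.2)) (μ.prod μ) :=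
      hf.1.comp_quasiMeasurePreserving (quasiMeasurePreserving_sub_of_right_invariant μ μ)
    have m2 : AEStronglyMeasurable (fun z : G × G => r z.2 • (f (-z.2 + z.1) - f z.1))
        (μ.prod μ) := by
      simp_rw [neg_add_eq_sub]
      exact (hrc.comp continuous_snd).aestronglyMeasurable.smul (m1.sub hf.1.comp_fst)
    exact m2.enorm
  calc ∫⁻ x, ‖(r ⋆[ContinuousLinearMap.lsmul ℝ ℝ, μ] f) x - f x‖ₑ ∂μ
      ≤ ∫⁻ x, ∫⁻ y, ‖r y • (f (-y + x) - f x)‖ₑ ∂μ ∂μ := by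
        refine lintegral_mono fun x => ?_
        rw [key x]
        exact enorm_integral_le_lintegral_enorm _
    _ = ∫⁻ y, ∫⁻ x, ‖r y • (f (-y + x) - f x)‖ₑ ∂μ ∂μ := lintegral_lintegral_swap hmeas
    _ ≤ ∫⁻ y, ‖r y‖ₑ * ε ∂μ := by
        refine lintegral_mono fun y => ?_
        simp_rw [enorm_smul]
        rw [lintegral_const_mul' _ _ enorm_ne_top]
        by_cases hy : r y = 0
        · simp [hy]
        · have hy' : y ∈ Function.support r := hy
          rw [hr, (ρ n).support_normed_eq] at hy'
          have hy2 : dist (-y) 0 < δ := by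
            rw [dist_zero_right, norm_neg]
            exact (mem_ball_zero_iff.1 hy').trans hn
          have := hball hy2
          rw [eLpNorm_one_eq_lintegral_enorm] at this
          gcongr
    _ = ε := by rw [lintegral_mul_const _ hrc.measurable.enorm, hr1, one_mul]

/-- A sequence of bump functions at the origin with radii tending to zero; the ratio of the outer
to the inner radius is fixed, so that the Lebesgue differentiation theorem applies. -/
noncomputable def mollifierBump (G : Type*) [NormedAddCommGroup G] (n : ℕ) :
    ContDiffBump (0 : G) :=
  ⟨1 / ((n : ℝ) + 1) / 2, 1 / ((n : ℝ) + 1), by positivity, by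
    have : (0 : ℝ) < 1 / ((n : ℝ) + 1) := by positivity
    linarith⟩

theorem tendsto_mollifierBump_rOut (G : Type*) [NormedAddCommGroup G] :
    Tendsto (fun n => (mollifierBump G n).rOut) atTop (𝓝 0) :=
  tendsto_one_div_add_atTop_nhds_zero_nat

theorem mollifierBump_rOut {G : Type*} [NormedAddCommGroup G] (n : ℕ) :
    (mollifierBump G n).rOut = 2 * (mollifierBump G n).rIn := by
  simp only [mollifierBump]
  ring

/-! ### The chain rule for weak derivatives -/

/-- `Y` is the weak derivative of `Z` in `Ω` in the direction `v`, for functions with values in a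
normed space. -/
def HasWeakDirDeriv {d : ℕ} {V : Type*} [NormedAddCommGroup V] [NormedSpace ℝ V]
    (Ω : Set (E d)) (v : E d) (Z Y : E d → V) : Prop :=
  ∀ φ : E d → ℝ, IsTest Ω φ → ∫ x in Ω, fderiv ℝ φ x v • Z x = -∫ x in Ω, φ x • Y x

/-- A reflected and translated bump is a test function in `Ω` as soon as its support lies in `Ω`. -/
theorem IsTest.comp_sub_left {d : ℕ} {Ω : Set (E d)} {r : E d → ℝ} (hr : ContDiff ℝ ∞ r)
    (hc : HasCompactSupport r) {x : E d} (hx : ∀ y, x - y ∈ tsupport r → y ∈ Ω) :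
    IsTest Ω fun y => r (x - y) := by
  have he : (fun y => r (x - y)) = r ∘ (Homeomorph.subLeft x) := rfl
  refine ⟨hr.comp (contDiff_const.sub contDiff_id), ?_, ?_⟩
  · rw [he]
    exact hc.comp_homeomorph _
  · intro y hy
    rw [he] at hy
    exact hx y (tsupport_comp_subset_preimage r (Homeomorph.subLeft x).continuous hy)

/-- At the points whose distance to the complement of `Ω` exceeds the size of the mollifier,
mollification commutes with the weak derivative. -/
theorem HasWeakDirDeriv.fderiv_convolution {d : ℕ} {V : Type*} [NormedAddCommGroup V]
    [NormedSpace ℝ V] [CompleteSpace V] {Ω : Set (E d)} (hΩ : MeasurableSet Ω) {v : E d}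
    {Z Y : E d → V} (h : HasWeakDirDeriv Ω v Z Y) (hZ : IntegrableOn Z Ω)
    {r : E d → ℝ} (hr : ContDiff ℝ ∞ r) (hc : HasCompactSupport r) {x : E d}
    (hx : ∀ y, x - y ∈ tsupport r → y ∈ Ω) :
    fderiv ℝ (r ⋆[ContinuousLinearMap.lsmul ℝ ℝ, volume] Ω.indicator Z) x v =
      (r ⋆[ContinuousLinearMap.lsmul ℝ ℝ, volume] Ω.indicator Y) x := by
  have hZi : Integrable (Ω.indicator Z) := (integrable_indicator_iff hΩ).2 hZ
  have hr1 : ContDiff ℝ 1 r := hr.of_le (by exact_mod_cast le_top)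
  rw [(hc.hasFDerivAt_convolution_left (ContinuousLinearMap.lsmul ℝ ℝ) hr1
    hZi.locallyIntegrable x).fderiv]
  have hint : Integrable (fun t => ((ContinuousLinearMap.lsmul ℝ ℝ).precompL (E d))
      (fderiv ℝ r t) (Ω.indicator Z (x - t))) := by
    exact (hc.fderiv ℝ).convolutionExists_left
      ((ContinuousLinearMap.lsmul ℝ ℝ).precompL (E d) : _ →L[ℝ] V →L[ℝ] _)
      (hr1.continuous_fderiv one_ne_zero) hZi.locallyIntegrable x
  rw [convolution_def, ContinuousLinearMap.integral_apply hint, convolution_eq_swap]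
  have hT := h _ (IsTest.comp_sub_left hr hc hx)
  have hfd : ∀ y, fderiv ℝ (fun y => r (x - y)) y v = -(fderiv ℝ r (x - y) v) := by
    intro y
    have h1 : HasFDerivAt (fun y => r (x - y))
        ((fderiv ℝ r (x - y)).comp (-ContinuousLinearMap.id ℝ (E d))) y :=
      (hr1.differentiable one_ne_zero).differentiableAt.hasFDerivAt.comp y
        ((hasFDerivAt_id y).const_sub x)
    rw [h1.fderiv]
    simp
  simp_rw [hfd] at hT
  rw [← integral_indicator hΩ, ← integral_indicator hΩ] at hT
  have e1 : ∫ t, ((ContinuousLinearMap.lsmul ℝ ℝ).precompL (E d))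
      (fderiv ℝ r t) (Ω.indicator Z (x - t)) v = ∫ t, fderiv ℝ r (x - t) v • Ω.indicator Z t := by
    rw [← integral_sub_left_eq_self _ volume x]
    simp [ContinuousLinearMap.precompL_apply]
  rw [e1]
  have e2 : ∀ t, fderiv ℝ r (x - t) v • Ω.indicator Z t
      = - Ω.indicator (fun x_1 => -(fderiv ℝ r (x - x_1) v) • Z x_1) t := by
    intro t; by_cases ht : t ∈ Ω <;> simp [ht]
  simp_rw [e2]
  rw [integral_neg, hT, neg_neg]
  refine integral_congr_ae (.of_forall fun t => ?_)
  by_cases ht : t ∈ Ω <;> simp [ht]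

/-- The chain rule for weak derivatives. It is the classical one for the mollifications, which near
the support of the test function are smooth with the mollified derivative; the limit uses their
convergence in `L¹` and almost everywhere. The vector-valued form contains the chain rule for a
function of several scalar Sobolev functions, in particular the product rule. -/
theorem HasWeakDirDeriv.comp {d : ℕ} {V : Type*} [NormedAddCommGroup V]
    [NormedSpace ℝ V] [CompleteSpace V] {Ω : Set (E d)} (hΩ : IsOpen Ω) {v : E d}
    {Z Y : E d → V} (h : HasWeakDirDeriv Ω v Z Y) (hZ : IntegrableOn Z Ω) (hY : IntegrableOn Y Ω)
    {G : V → ℝ} (hG : ContDiff ℝ 1 G) {L : ℝ} (hL : ∀ z, ‖fderiv ℝ G z‖ ≤ L) :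
    HasWeakDirDeriv Ω v (fun x => G (Z x)) (fun x => fderiv ℝ G (Z x) (Y x)) := by
  intro φ hφ
  -- extend by zero, so that the mollifications are defined on the whole space
  set Zt := Ω.indicator Z with hZt
  set Yt := Ω.indicator Y with hYt
  have hZi : Integrable Zt := (integrable_indicator_iff hΩ.measurableSet).2 hZ
  have hYi : Integrable Yt := (integrable_indicator_iff hΩ.measurableSet).2 hY
  have hL0 : 0 ≤ L := (norm_nonneg _).trans (hL 0)
  have hGlip : ∀ x y, ‖G x - G y‖ ≤ L * ‖x - y‖ := fun x y =>
    convex_univ.norm_image_sub_le_of_norm_fderiv_le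
      (fun z _ => (hG.differentiable one_ne_zero).differentiableAt) (fun z _ => hL z)
      (mem_univ y) (mem_univ x)
  have hG'c : Continuous (fderiv ℝ G) := hG.continuous_fderiv one_ne_zero
  let ρ := mollifierBump (E d)
  have hρ := tendsto_mollifierBump_rOut (E d)
  have hρ' : ∀ᶠ n in atTop, (ρ n).rOut ≤ 2 * (ρ n).rIn :=
    .of_forall fun n => (mollifierBump_rOut n).le
  let r : ℕ → E d → ℝ := fun n => (ρ n).normed volume
  have hrs : ∀ n, ContDiff ℝ ∞ (r n) := fun n => (ρ n).contDiff_normed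
  have hrc : ∀ n, HasCompactSupport (r n) := fun n => (ρ n).hasCompactSupport_normed
  let F : ℕ → E d → V := fun n => r n ⋆[ContinuousLinearMap.lsmul ℝ ℝ, volume] Zt
  let H : ℕ → E d → V := fun n => r n ⋆[ContinuousLinearMap.lsmul ℝ ℝ, volume] Yt
  have hFs : ∀ n, ContDiff ℝ 1 (F n) := fun n =>
    (hrc n).contDiff_convolution_left _ ((hrs n).of_le (by exact_mod_cast le_top))
      hZi.locallyIntegrable
  have hHs : ∀ n, Continuous (H n) := fun n =>
    (hrc n).continuous_convolution_left _ (hrs n).continuous hYi.locallyIntegrable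
  have hF1 := tendsto_lintegral_enorm_convolution_sub hZi hρ
  have hH1 := tendsto_lintegral_enorm_convolution_sub hYi hρ
  have hFa : ∀ᵐ x, Tendsto (fun n => F n x) atTop (𝓝 (Zt x)) :=
    ContDiffBump.ae_convolution_tendsto_right_of_locallyIntegrable hρ hρ' hZi.locallyIntegrable
  have hφc : Continuous φ := hφ.1.continuous
  have hdφc : Continuous (fun x => fderiv ℝ φ x v) :=
    (hφ.1.continuous_fderiv (by simp)).clm_apply continuous_const
  have hdφs : HasCompactSupport (fun x => fderiv ℝ φ x v) := hφ.2.1.fderiv_apply (𝕜 := ℝ) v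
  obtain ⟨M, hM⟩ := hφ.2.1.exists_bound_of_continuous hφc
  obtain ⟨M', hM'⟩ := hdφs.exists_bound_of_continuous hdφc
  have hM0 : 0 ≤ M := (norm_nonneg _).trans (hM 0)
  have hM'0 : 0 ≤ M' := (norm_nonneg _).trans (hM' 0)
  -- the identity holds for the mollified functions near the support of `φ`
  have hpar : ∀ᶠ n in atTop, ∫ x, G (F n x) * fderiv ℝ φ x v =
      -∫ x, fderiv ℝ G (F n x) (H n x) * φ x := by
    obtain ⟨δ, hδ, hsub⟩ := hφ.2.1.isCompact.exists_cthickening_subset_open hΩ hφ.2.2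
    filter_upwards [(tendsto_order.1 hρ).2 δ hδ] with n hn
    have hGF : ContDiff ℝ 1 (fun x => G (F n x)) := hG.comp (hFs n)
    have hd : ∀ x, fderiv ℝ (fun x => G (F n x)) x v * φ x =
        fderiv ℝ G (F n x) (H n x) * φ x := by
      intro x
      by_cases hx : x ∈ tsupport φ
      · have e1 : fderiv ℝ (fun x => G (F n x)) x =
            (fderiv ℝ G (F n x)).comp (fderiv ℝ (F n) x) :=
          fderiv_comp x (hG.differentiable one_ne_zero).differentiableAt
            ((hFs n).differentiable one_ne_zero).differentiableAt
        have e2 : fderiv ℝ (F n) x v = H n x := by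
          refine h.fderiv_convolution hΩ.measurableSet hZ (hrs n) (hrc n) fun y hy => ?_
          rw [(ρ n).tsupport_normed_eq, mem_closedBall_zero_iff] at hy
          refine hsub (Metric.mem_cthickening_of_dist_le y x δ _ hx ?_)
          rw [dist_comm, dist_eq_norm]
          exact hy.trans hn.le
        rw [e1, ContinuousLinearMap.comp_apply, e2]
      · rw [image_eq_zero_of_notMem_tsupport hx, mul_zero, mul_zero]
    have hgc : Continuous fun x => fderiv ℝ (fun x => G (F n x)) x v :=
      (hGF.continuous_fderiv one_ne_zero).clm_apply continuous_const
    rw [integral_mul_fderiv_eq_neg_fderiv_mul_of_integrable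
      ((hgc.mul hφc).integrable_of_hasCompactSupport hφ.2.1.mul_left)
      ((hGF.continuous.mul hdφc).integrable_of_hasCompactSupport hdφs.mul_left)
      ((hGF.continuous.mul hφc).integrable_of_hasCompactSupport hφ.2.1.mul_left)
      (fun x _ => (hGF.differentiable one_ne_zero).differentiableAt)
      (fun x _ => (hφ.1.differentiable (by simp)).differentiableAt)]
    simp_rw [hd]
  have hleft : Tendsto (fun n => ∫ x, G (F n x) * fderiv ℝ φ x v) atTop
      (𝓝 (∫ x, G (Zt x) * fderiv ℝ φ x v)) := by
    have hGZ : Integrable fun x => G (Zt x) * fderiv ℝ φ x v := by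
      have h1 : Integrable fun x => (G (Zt x) - G 0) * fderiv ℝ φ x v := by
        refine Integrable.mul_bdd (c := M') ?_ hdφc.aestronglyMeasurable (.of_forall hM')
        refine (hZi.norm.const_mul L).mono'
          ((hG.continuous.comp_aestronglyMeasurable hZi.1).sub aestronglyMeasurable_const)
          (.of_forall fun x => ?_)
        simpa using hGlip (Zt x) 0
      have h2 : Integrable fun x => G 0 * fderiv ℝ φ x v :=
        (hdφc.integrable_of_hasCompactSupport hdφs).const_mul _
      refine (h1.add h2).congr (.of_forall fun x => ?_)
      simp only [Pi.add_apply]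
      ring
    refine tendsto_integral_of_L1 _ hGZ.aestronglyMeasurable (.of_forall fun n =>
      (((hG.continuous.comp (hFs n).continuous).mul hdφc).integrable_of_hasCompactSupport
        hdφs.mul_left)) ?_
    have hz : Tendsto (fun n => ENNReal.ofReal (L * M') * ∫⁻ x, ‖F n x - Zt x‖ₑ) atTop (𝓝 0) := by
      simpa using ENNReal.Tendsto.const_mul hF1 (Or.inr ENNReal.ofReal_ne_top)
    refine tendsto_of_tendsto_of_tendsto_of_le_of_le tendsto_const_nhds hz
      (fun _ => zero_le) fun n => ?_
    beta_reduce
    rw [← lintegral_const_mul' _ _ ENNReal.ofReal_ne_top]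
    refine lintegral_mono fun x => ?_
    rw [← sub_mul, ← ofReal_norm, ← ofReal_norm, ← ENNReal.ofReal_mul (by positivity)]
    refine ENNReal.ofReal_le_ofReal ?_
    rw [norm_mul]
    calc _ ≤ L * ‖F n x - Zt x‖ * M' := by gcongr; exacts [hGlip _ _, hM' x]
      _ = _ := by ring
  have hright : Tendsto (fun n => ∫ x, fderiv ℝ G (F n x) (H n x) * φ x) atTop
      (𝓝 (∫ x, fderiv ℝ G (Zt x) (Yt x) * φ x)) := by
    have hmG : ∀ n, Continuous fun x => fderiv ℝ G (F n x) := fun n =>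
      hG'c.comp (hFs n).continuous
    have hG'Y : ∀ n, Integrable fun x => fderiv ℝ G (F n x) (Yt x) * φ x := fun n => by
      refine (hYi.norm.const_mul (L * M)).mono'
        ((isBoundedBilinearMap_apply.continuous.comp_aestronglyMeasurable
          ((hmG n).aestronglyMeasurable.prodMk hYi.1)).mul hφc.aestronglyMeasurable)
        (.of_forall fun x => ?_)
      rw [norm_mul]
      calc _ ≤ L * ‖Yt x‖ * M := by
            gcongr
            exacts [(fderiv ℝ G (F n x)).le_of_opNorm_le (hL _) _, hM x]
        _ = _ := by ring
    have h1 : Tendsto (fun n => ∫ x, fderiv ℝ G (F n x) (Yt x) * φ x) atTop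
        (𝓝 (∫ x, fderiv ℝ G (Zt x) (Yt x) * φ x)) := by
      refine tendsto_integral_of_dominated_convergence (fun x => L * ‖Yt x‖ * M)
        (fun n => (hG'Y n).aestronglyMeasurable) ((hYi.norm.const_mul L).mul_const M)
        (fun n => .of_forall fun x => ?_) ?_
      · rw [norm_mul]
        gcongr
        exacts [(fderiv ℝ G (F n x)).le_of_opNorm_le (hL _) _, hM x]
      · filter_upwards [hFa] with x hx
        have h0 : Tendsto (fun n => fderiv ℝ G (F n x)) atTop (𝓝 (fderiv ℝ G (Zt x))) :=
          (hG'c.tendsto _).comp hx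
        exact (((ContinuousLinearMap.apply ℝ ℝ (Yt x)).continuous.tendsto _).comp h0).mul_const _
    -- the error made by replacing the mollified derivative `H n` by `Yt` vanishes in `L¹`
    have h2 : Tendsto (fun n => ∫ x, fderiv ℝ G (F n x) (H n x - Yt x) * φ x) atTop (𝓝 0) := by
      have hz : Tendsto (fun n => ENNReal.ofReal (L * M) * ∫⁻ x, ‖H n x - Yt x‖ₑ) atTop
          (𝓝 0) := by
        simpa using ENNReal.Tendsto.const_mul hH1 (Or.inr ENNReal.ofReal_ne_top)
      rw [tendsto_zero_iff_enorm_tendsto_zero]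
      refine tendsto_of_tendsto_of_tendsto_of_le_of_le tendsto_const_nhds hz
        (fun _ => zero_le) fun n => (enorm_integral_le_lintegral_enorm _).trans ?_
      beta_reduce
      rw [← lintegral_const_mul' _ _ ENNReal.ofReal_ne_top]
      refine lintegral_mono fun x => ?_
      rw [← ofReal_norm, ← ofReal_norm, ← ENNReal.ofReal_mul (by positivity)]
      refine ENNReal.ofReal_le_ofReal ?_
      rw [norm_mul]
      calc _ ≤ L * ‖H n x - Yt x‖ * M := by
            gcongr
            exacts [(fderiv ℝ G (F n x)).le_of_opNorm_le (hL _) _, hM x]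
        _ = _ := by ring
    have h3 := h2.add h1
    rw [zero_add] at h3
    refine h3.congr fun n => ?_
    have hi : Integrable fun x => fderiv ℝ G (F n x) (H n x) * φ x :=
      ((((hmG n).clm_apply (hHs n))).mul hφc).integrable_of_hasCompactSupport hφ.2.1.mul_left
    have he : (fun x => fderiv ℝ G (F n x) (H n x - Yt x) * φ x) = fun x =>
        fderiv ℝ G (F n x) (H n x) * φ x - fderiv ℝ G (F n x) (Yt x) * φ x := by
      funext x
      rw [map_sub, sub_mul]
    rw [he, integral_sub hi (hG'Y n)]
    ring
  have hlim := tendsto_nhds_unique (hleft.congr' hpar) hright.neg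
  have z1 : ∀ x, x ∉ Ω → φ x = 0 := fun x hx =>
    image_eq_zero_of_notMem_tsupport fun h => hx (hφ.2.2 h)
  have z2 : ∀ x, x ∉ Ω → fderiv ℝ φ x v = 0 := fun x hx => by
    have : fderiv ℝ φ x = 0 :=
      image_eq_zero_of_notMem_tsupport fun h => hx (hφ.2.2 (tsupport_fderiv_subset ℝ h))
    simp [this]
  rw [← setIntegral_eq_integral_of_forall_compl_eq_zero (s := Ω) (μ := volume)
      (f := fun x => G (Zt x) * fderiv ℝ φ x v) (fun x hx => by simp [z2 x hx]),
    ← setIntegral_eq_integral_of_forall_compl_eq_zero (s := Ω) (μ := volume)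
      (f := fun x => fderiv ℝ G (Zt x) (Yt x) * φ x) (fun x hx => by simp [z1 x hx])] at hlim
  have c1 : ∫ x in Ω, fderiv ℝ φ x v • G (Z x) = ∫ x in Ω, G (Zt x) * fderiv ℝ φ x v :=
    setIntegral_congr_fun hΩ.measurableSet fun x hx => by
      simp only [hZt, indicator_of_mem hx, smul_eq_mul, mul_comm]
  have c2 : ∫ x in Ω, φ x • fderiv ℝ G (Z x) (Y x) =
      ∫ x in Ω, fderiv ℝ G (Zt x) (Yt x) * φ x :=
    setIntegral_congr_fun hΩ.measurableSet fun x hx => by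
      simp only [hZt, hYt, indicator_of_mem hx, smul_eq_mul, mul_comm]
  rw [c1, c2, hlim]

/-! ### The Sobolev space `H¹(Ω)` -/

/-- The Cauchy–Schwarz inequality, in the form in which the terms of the weak formulation are
estimated; `F` need not be measurable. -/
theorem abs_integral_le_of_ae_le_norm_mul_norm {α X Y : Type*} [MeasurableSpace α] {μ : Measure α}
    [NormedAddCommGroup X] [NormedAddCommGroup Y] (f : Lp X 2 μ) (g : Lp Y 2 μ) {K : ℝ}
    (hK : 0 ≤ K) {F : α → ℝ} (hF : ∀ᵐ x ∂μ, |F x| ≤ K * (‖f x‖ * ‖g x‖)) :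
    |∫ x, F x ∂μ| ≤ K * (‖f‖ * ‖g‖) := by
  have hf := (Lp.memLp f).norm
  have hg := (Lp.memLp g).norm
  have hfg : Integrable (fun x => ‖f x‖ * ‖g x‖) μ := hf.integrable_mul hg
  have h1 : |∫ x, F x ∂μ| ≤ ∫ x, K * (‖f x‖ * ‖g x‖) ∂μ :=
    norm_integral_le_of_norm_le (f := F) (hfg.const_mul K) hF
  refine h1.trans ?_
  rw [integral_const_mul]
  refine mul_le_mul_of_nonneg_left ?_ hK
  have h2 := real_inner_le_norm (hf.toLp _) (hg.toLp _)
  rw [L2.inner_def, Lp.norm_toLp, Lp.norm_toLp, eLpNorm_norm, eLpNorm_norm] at h2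
  refine le_trans (le_of_eq (integral_congr_ae ?_)) h2
  filter_upwards [hf.coeFn_toLp, hg.coeFn_toLp] with x h3 h4
  simp [h3, h4, mul_comm]

section H1

variable {d : ℕ} {Ω : Set (E d)}

theorem H1.hasWeakGrad (φ : H1 Ω) : HasWeakGrad Ω φ.fn φ.grad := φ.2

/-- The element of `H¹(Ω)` given by a function and its weak gradient. -/
noncomputable def H1.mk (f : L2 Ω) (g : L2vec Ω) (h : HasWeakGrad Ω f g) : H1 Ω :=
  ⟨WithLp.toLp 2 (f, g), h⟩

theorem H1.norm_sq (φ : H1 Ω) : ‖φ‖ ^ 2 = ‖φ.fn‖ ^ 2 + ‖φ.grad‖ ^ 2 :=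
  WithLp.prod_norm_sq_eq_of_L2 φ.val

theorem H1.norm_fn_le (φ : H1 Ω) : ‖φ.fn‖ ≤ ‖φ‖ :=
  le_of_sq_le_sq (by rw [H1.norm_sq]; nlinarith [sq_nonneg ‖φ.grad‖]) (norm_nonneg _)

theorem H1.norm_grad_le (φ : H1 Ω) : ‖φ.grad‖ ≤ ‖φ‖ :=
  le_of_sq_le_sq (by rw [H1.norm_sq]; nlinarith [sq_nonneg ‖φ.fn‖]) (norm_nonneg _)

theorem H1.fn_sub (φ ψ : H1 Ω) : (φ - ψ).fn = φ.fn - ψ.fn := rfl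

theorem H1.grad_sub (φ ψ : H1 Ω) : (φ - ψ).grad = φ.grad - ψ.grad := rfl

/-- The inclusion of `H¹(Ω)` into `L²(Ω)`. -/
noncomputable def H1.fnL (Ω : Set (E d)) : H1 Ω →L[ℝ] L2 Ω :=
  LinearMap.mkContinuous ⟨⟨H1.fn, fun _ _ => rfl⟩, fun _ _ => rfl⟩ 1 fun φ => by
    rw [one_mul]; exact φ.norm_fn_le

theorem H1.hasWeakDirDeriv_pair (φ ψ : H1 Ω) (v : E d) [IsFiniteMeasure (vol Ω)] :
    HasWeakDirDeriv Ω v (fun x => (φ.fn x, ψ.fn x))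
      (fun x => (⟪v, φ.grad x⟫, ⟪v, ψ.grad x⟫)) := by
  intro η hη
  have i1 : ∀ χ : H1 Ω, Integrable (fun x => fderiv ℝ η x v * χ.fn x) (vol Ω) := fun χ => by
    simpa only [mul_comm] using hη.integrable_mul_fderiv χ.fn v
  have i2 : ∀ χ : H1 Ω, Integrable (fun x => η x * ⟪v, χ.grad x⟫) (vol Ω) := fun χ => by
    simpa only [mul_comm] using hη.integrable_inner_mul χ.grad v
  have h : ∀ χ : H1 Ω, ∫ x in Ω, fderiv ℝ η x v * χ.fn x = -∫ x in Ω, η x * ⟪v, χ.grad x⟫ :=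
    fun χ => by simpa only [mul_comm] using χ.hasWeakGrad η hη v
  simp only [Prod.smul_mk, smul_eq_mul]
  rw [integral_pair (i1 φ) (i1 ψ), integral_pair (i2 φ) (i2 ψ), h φ, h ψ]
  rfl

/-- `G(φ, ψ) ∈ H¹(Ω)` for `φ, ψ ∈ H¹(Ω)` and `G` of class `C¹` with bounded derivative. Finiteness
of the measure of `Ω` makes up for `G` not vanishing at the origin. -/
theorem H1.exists_comp₂ (hΩ : IsOpen Ω) [IsFiniteMeasure (vol Ω)] (φ ψ : H1 Ω)
    {G : ℝ × ℝ → ℝ} (hG : ContDiff ℝ 1 G) {L : ℝ} (hL : ∀ z, ‖fderiv ℝ G z‖ ≤ L) :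
    ∃ χ : H1 Ω, (∀ᵐ x ∂(vol Ω), χ.fn x = G (φ.fn x, ψ.fn x)) ∧
      ∀ᵐ x ∂(vol Ω), χ.grad x = fderiv ℝ G (φ.fn x, ψ.fn x) (1, 0) • φ.grad x +
        fderiv ℝ G (φ.fn x, ψ.fn x) (0, 1) • ψ.grad x := by
  have hG'c : Continuous (fderiv ℝ G) := hG.continuous_fderiv one_ne_zero
  have hGlip : ∀ x y, ‖G x - G y‖ ≤ L * ‖x - y‖ := fun x y =>
    convex_univ.norm_image_sub_le_of_norm_fderiv_le
      (fun z _ => (hG.differentiable one_ne_zero).differentiableAt) (fun z _ => hL z)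
      (mem_univ y) (mem_univ x)
  have hL0 : 0 ≤ L := (norm_nonneg _).trans (hL 0)
  have mφ := Lp.memLp φ.fn
  have mψ := Lp.memLp ψ.fn
  have mz : AEStronglyMeasurable (fun x => (φ.fn x, ψ.fn x)) (vol Ω) := mφ.1.prodMk mψ.1
  have hf : MemLp (fun x => G (φ.fn x, ψ.fn x)) 2 (vol Ω) := by
    have hadd : MemLp (fun x => ‖φ.fn x‖ + ‖ψ.fn x‖) 2 (vol Ω) := mφ.norm.add mψ.norm
    have h1 : MemLp (fun x => G (φ.fn x, ψ.fn x) - G 0) 2 (vol Ω) := by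
      refine MemLp.of_le_mul (c := L) hadd
        ((hG.continuous.comp_aestronglyMeasurable mz).sub aestronglyMeasurable_const)
        (.of_forall fun x => (hGlip _ _).trans ?_)
      refine mul_le_mul_of_nonneg_left ?_ hL0
      simp only [sub_zero, Prod.norm_mk]
      rw [Real.norm_of_nonneg (add_nonneg (norm_nonneg (φ.fn x)) (norm_nonneg (ψ.fn x)))]
      exact max_le (by linarith [norm_nonneg (ψ.fn x)]) (by linarith [norm_nonneg (φ.fn x)])
    refine (h1.add (memLp_const (G 0))).ae_eq (.of_forall fun x => ?_)
    simp
  have hcoef : ∀ (w : ℝ × ℝ), ‖w‖ ≤ 1 → ∀ χ : H1 Ω,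
      MemLp (fun x => fderiv ℝ G (φ.fn x, ψ.fn x) w • χ.grad x) 2 (vol Ω) := by
    intro w hw χ
    have hm : Continuous fun z => fderiv ℝ G z w := hG'c.clm_apply continuous_const
    refine MemLp.of_le_mul (c := L) (Lp.memLp χ.grad)
      ((hm.comp_aestronglyMeasurable mz).smul (Lp.memLp χ.grad).1) (.of_forall fun x => ?_)
    rw [norm_smul]
    gcongr
    calc _ ≤ ‖fderiv ℝ G (φ.fn x, ψ.fn x)‖ * ‖w‖ := ContinuousLinearMap.le_opNorm _ _
      _ ≤ L * 1 := by gcongr; exact hL _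
      _ = L := mul_one L
  have hg := (hcoef (1, 0) (by simp [Prod.norm_mk]) φ).add (hcoef (0, 1) (by simp [Prod.norm_mk]) ψ)
  have hgrad : HasWeakGrad Ω (hf.toLp _) (hg.toLp _) := by
    intro η hη v
    have hi : ∀ χ : H1 Ω, Integrable (fun x => ⟪v, χ.grad x⟫) (vol Ω) := fun χ =>
      ((Lp.memLp χ.grad).const_inner v).integrable (by norm_num)
    have h := (H1.hasWeakDirDeriv_pair φ ψ v).comp hΩ
      ((mφ.integrable (by norm_num)).prodMk (mψ.integrable (by norm_num)))
      ((hi φ).prodMk (hi ψ)) hG hL η hη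
    have e1 : ∫ x in Ω, (hf.toLp _) x * fderiv ℝ η x v =
        ∫ x in Ω, fderiv ℝ η x v • G (φ.fn x, ψ.fn x) := by
      refine integral_congr_ae ?_
      filter_upwards [hf.coeFn_toLp] with x hx
      rw [hx, smul_eq_mul, mul_comm]
    have e2 : ∫ x in Ω, ⟪v, (hg.toLp _) x⟫ * η x =
        ∫ x in Ω, η x • fderiv ℝ G (φ.fn x, ψ.fn x) (⟪v, φ.grad x⟫, ⟪v, ψ.grad x⟫) := by
      refine integral_congr_ae ?_
      filter_upwards [hg.coeFn_toLp] with x hx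
      have hs : ((⟪v, φ.grad x⟫, ⟪v, ψ.grad x⟫) : ℝ × ℝ) =
          ⟪v, φ.grad x⟫ • ((1, 0) : ℝ × ℝ) + ⟪v, ψ.grad x⟫ • ((0, 1) : ℝ × ℝ) := by simp
      rw [hx, hs, map_add, map_smul, map_smul, Pi.add_apply, inner_add_right,
        real_inner_smul_right, real_inner_smul_right]
      simp only [smul_eq_mul]
      ring
    rw [e1, e2, h]
  exact ⟨H1.mk _ _ hgrad, hf.coeFn_toLp, hg.coeFn_toLp⟩

theorem H1.exists_comp (hΩ : IsOpen Ω) [IsFiniteMeasure (vol Ω)] (φ : H1 Ω)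
    {p : ℝ → ℝ} (hp : ContDiff ℝ 1 p) {L : ℝ} (hL : ∀ z, |deriv p z| ≤ L) :
    ∃ χ : H1 Ω, (∀ᵐ x ∂(vol Ω), χ.fn x = p (φ.fn x)) ∧
      ∀ᵐ x ∂(vol Ω), χ.grad x = deriv p (φ.fn x) • φ.grad x := by
  have hd : ∀ z : ℝ × ℝ, fderiv ℝ (fun z : ℝ × ℝ => p z.1) z =
      deriv p z.1 • ContinuousLinearMap.fst ℝ ℝ ℝ := fun z =>
    ((hp.differentiable one_ne_zero).differentiableAt.hasDerivAt.comp_hasFDerivAt z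
      hasFDerivAt_fst).fderiv
  obtain ⟨χ, h1, h2⟩ := H1.exists_comp₂ hΩ φ φ (G := fun z => p z.1) (hp.comp contDiff_fst)
    (L := L) (fun z => by
      rw [hd, norm_smul]
      calc _ ≤ L * 1 := by
            gcongr
            · exact (abs_nonneg _).trans (hL 0)
            · exact hL _
            · exact ContinuousLinearMap.norm_fst_le ℝ ℝ ℝ
        _ = L := mul_one L)
  refine ⟨χ, h1, ?_⟩
  filter_upwards [h2] with x hx
  simp [hx, hd]

/-- `p(φ) q(ψ) ∈ H¹(Ω)` for `φ, ψ ∈ H¹(Ω)` and `p`, `q` of class `C¹`, bounded with their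
derivatives; only the gradient of the product is recorded. -/
theorem H1.exists_mul_comp (hΩ : IsOpen Ω) [IsFiniteMeasure (vol Ω)] (φ ψ : H1 Ω)
    {p q : ℝ → ℝ} (hp : ContDiff ℝ 1 p) (hq : ContDiff ℝ 1 q) {L M : ℝ}
    (hpM : ∀ z, |p z| ≤ M) (hqM : ∀ z, |q z| ≤ M)
    (hpL : ∀ z, |deriv p z| ≤ L) (hqL : ∀ z, |deriv q z| ≤ L) :
    ∃ χ : H1 Ω, ∀ᵐ x ∂(vol Ω), χ.grad x = (deriv p (φ.fn x) * q (ψ.fn x)) • φ.grad x +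
        (p (φ.fn x) * deriv q (ψ.fn x)) • ψ.grad x := by
  have hM0 : 0 ≤ M := (abs_nonneg _).trans (hpM 0)
  have hL0 : 0 ≤ L := (abs_nonneg _).trans (hpL 0)
  have hd : ∀ z : ℝ × ℝ, fderiv ℝ (fun z : ℝ × ℝ => p z.1 * q z.2) z =
      p z.1 • (deriv q z.2 • ContinuousLinearMap.snd ℝ ℝ ℝ) +
      q z.2 • (deriv p z.1 • ContinuousLinearMap.fst ℝ ℝ ℝ) := fun z =>
    (((hp.differentiable one_ne_zero).differentiableAt.hasDerivAt.comp_hasFDerivAt z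
      hasFDerivAt_fst).mul
      ((hq.differentiable one_ne_zero).differentiableAt.hasDerivAt.comp_hasFDerivAt z
      hasFDerivAt_snd)).fderiv
  obtain ⟨χ, h1, h2⟩ := H1.exists_comp₂ hΩ φ ψ (G := fun z => p z.1 * q z.2)
    ((hp.comp contDiff_fst).mul (hq.comp contDiff_snd))
    (L := M * (L * 1) + M * (L * 1)) (fun z => by
      rw [hd]
      refine (norm_add_le _ _).trans (add_le_add ?_ ?_)
      · rw [norm_smul, norm_smul]
        gcongr
        exacts [hpM _, hqL _, ContinuousLinearMap.norm_snd_le ℝ ℝ ℝ]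
      · rw [norm_smul, norm_smul]
        gcongr
        exacts [hqM _, hpL _, ContinuousLinearMap.norm_fst_le ℝ ℝ ℝ])
  refine ⟨χ, ?_⟩
  filter_upwards [h2] with x hx
  simp [hx, hd, mul_comm]

/-- Solenoidal fields are orthogonal to gradients: the weak divergence that defines the normal trace
is unique, hence zero. -/
theorem integral_inner_grad_eq_zero_of_mem_solenoidal (hΩ : IsOpen Ω) {u : L2vec Ω}
    (hu : u ∈ solenoidal Ω) (φ : H1 Ω) : ∫ x in Ω, ⟪u x, φ.grad x⟫ = 0 := by
  obtain ⟨⟨q, hq, hq'⟩, h0⟩ := hu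
  have hloc : LocallyIntegrableOn q Ω :=
    locallyIntegrableOn_of_locallyIntegrable_restrict
      ((Lp.memLp q).locallyIntegrable (by norm_num))
  have hq0 : ∀ᵐ x, x ∈ Ω → q x = 0 := by
    refine hΩ.ae_eq_zero_of_integral_contDiff_smul_eq_zero hloc fun η h1 h2 h3 => ?_
    have ht : IsTest Ω η := ⟨h1, h2, h3⟩
    have h4 := (hq η ht).symm.trans (h0 η ht)
    have h5 : ∫ x in Ω, (0 : L2 Ω) x * η x = 0 := by
      refine integral_eq_zero_of_ae ?_
      filter_upwards [Lp.coeFn_zero ℝ 2 (vol Ω)] with x hx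
      rw [hx, Pi.zero_apply, zero_mul]
    rw [h5, neg_inj] at h4
    rw [← setIntegral_eq_integral_of_forall_compl_eq_zero (s := Ω) (μ := volume)]
    · simpa only [smul_eq_mul, mul_comm] using h4
    · intro x hx
      rw [image_eq_zero_of_notMem_tsupport fun h => hx (h3 h), zero_smul]
  have := hq' φ
  have e : ∫ x in Ω, q x * φ.fn x = 0 := by
    refine integral_eq_zero_of_ae ?_
    filter_upwards [(ae_restrict_iff' hΩ.measurableSet).2 hq0] with x hx
    simp [hx]
  rwa [e, add_zero] at this

/-! ### Truncations of the identity -/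

/-- The truncation `s ↦ N arctan (s / N)` of the identity at level `N`. -/
noncomputable def arctanTrunc (N s : ℝ) : ℝ := N * Real.arctan (s / N)

theorem hasDerivAt_arctanTrunc {N : ℝ} (hN : N ≠ 0) (s : ℝ) :
    HasDerivAt (arctanTrunc N) (1 / (1 + (s / N) ^ 2)) s := by
  have h := (((hasDerivAt_id s).div_const N).arctan).const_mul N
  refine h.congr_deriv ?_
  simp only [id]
  field_simp

theorem contDiff_arctanTrunc (N : ℝ) : ContDiff ℝ 1 (arctanTrunc N) :=
  contDiff_const.mul ((contDiff_id.div_const N).arctan)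

theorem deriv_arctanTrunc {N : ℝ} (hN : N ≠ 0) (s : ℝ) :
    deriv (arctanTrunc N) s = 1 / (1 + (s / N) ^ 2) := (hasDerivAt_arctanTrunc hN s).deriv

theorem abs_deriv_arctanTrunc_le {N : ℝ} (hN : N ≠ 0) (s : ℝ) :
    |deriv (arctanTrunc N) s| ≤ 1 := by
  rw [deriv_arctanTrunc hN, abs_of_pos (by positivity), div_le_one (by positivity)]
  nlinarith [sq_nonneg (s / N)]

theorem abs_arctanTrunc_le {N : ℝ} (hN : 0 < N) (s : ℝ) : |arctanTrunc N s| ≤ N * 2 := by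
  rw [arctanTrunc, abs_mul, abs_of_pos hN]
  gcongr
  have h1 := Real.arctan_lt_pi_div_two (s / N)
  have h2 := Real.neg_pi_div_two_lt_arctan (s / N)
  have h3 := Real.pi_le_four
  exact abs_le.2 ⟨by linarith, by linarith⟩

theorem abs_arctanTrunc_le_abs {N : ℝ} (hN : N ≠ 0) (s : ℝ) : |arctanTrunc N s| ≤ |s| := by
  have h := convex_univ.norm_image_sub_le_of_norm_hasDerivWithin_le (C := 1) (x := 0) (y := s)
    (fun x _ => (hasDerivAt_arctanTrunc hN x).hasDerivWithinAt)
    (fun x _ => by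
      rw [← deriv_arctanTrunc hN]; exact abs_deriv_arctanTrunc_le hN x) (mem_univ _) (mem_univ _)
  simpa [arctanTrunc] using h

theorem tendsto_arctanTrunc (s : ℝ) :
    Tendsto (fun n : ℕ => arctanTrunc ((n : ℝ) + 1) s) atTop (𝓝 s) := by
  have h1 : HasDerivAt (fun t : ℝ => Real.arctan (s * t)) s 0 := by
    have := ((hasDerivAt_id (0 : ℝ)).const_mul s).arctan
    simpa using this
  have h2 := h1.tendsto_slope_zero
  have h3 : Tendsto (fun n : ℕ => 1 / ((n : ℝ) + 1)) atTop (𝓝[≠] 0) :=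
    tendsto_nhdsWithin_iff.2 ⟨tendsto_one_div_add_atTop_nhds_zero_nat,
      .of_forall fun n => by
        have : (0 : ℝ) < 1 / ((n : ℝ) + 1) := by positivity
        exact this.ne'⟩
  refine (h2.comp h3).congr fun n => ?_
  simp [arctanTrunc, div_eq_mul_inv]

theorem tendsto_deriv_arctanTrunc (s : ℝ) :
    Tendsto (fun n : ℕ => deriv (arctanTrunc ((n : ℝ) + 1)) s) atTop (𝓝 1) := by
  have h : Tendsto (fun n : ℕ => 1 / (1 + (s * (1 / ((n : ℝ) + 1))) ^ 2)) atTop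
      (𝓝 (1 / (1 + (s * 0) ^ 2))) :=
    tendsto_const_nhds.div (tendsto_const_nhds.add
      ((tendsto_const_nhds.mul tendsto_one_div_add_atTop_nhds_zero_nat).pow 2)) (by positivity)
  refine (h.congr fun n => ?_).trans (by simp)
  rw [deriv_arctanTrunc (by positivity)]
  ring

/-! ### The convection term -/

/-- The identity `∫ u · ∇(φ b(ψ)) = 0` for a solenoidal field `u`. The product `φ b(ψ)` need not
lie in `H¹(Ω)`, so `φ` is truncated first; the truncation is removed by dominated convergence,
where `φ u ∈ L²(Ω)^d` provides the majorant. -/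
theorem integral_convection_add_eq_zero (hΩ : IsOpen Ω) [IsFiniteMeasure (vol Ω)] {u : L2vec Ω}
    (hu : u ∈ solenoidal Ω) (φ ψ : H1 Ω) {b : ℝ → ℝ} (hb : ContDiff ℝ 1 b)
    {L : ℝ} (hb1 : ∀ s, |b s| ≤ 1) (hbL : ∀ s, |deriv b s| ≤ L)
    (hφu : MemLp (fun x => φ.fn x • u x) 2 (vol Ω)) :
    ∫ x in Ω, (b (ψ.fn x) * ⟪u x, φ.grad x⟫ +
      deriv b (ψ.fn x) * ⟪φ.fn x • u x, ψ.grad x⟫) = 0 := by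
  have hL0 : 0 ≤ L := (abs_nonneg _).trans (hbL 0)
  have mφ := Lp.memLp φ.fn
  have mψ := Lp.memLp ψ.fn
  have hbc : Continuous (deriv b) := hb.continuous_deriv le_rfl
  let T : ℕ → ℝ → ℝ := fun n => arctanTrunc ((n : ℝ) + 1)
  have hN : ∀ n : ℕ, (0 : ℝ) < (n : ℝ) + 1 := fun n => by positivity
  have hTc : ∀ n, Continuous (T n) := fun n => (contDiff_arctanTrunc _).continuous
  have hT'c : ∀ n, Continuous (deriv (T n)) := fun n =>
    (contDiff_arctanTrunc _).continuous_deriv le_rfl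
  let F : ℕ → E d → ℝ := fun n x => deriv (T n) (φ.fn x) * b (ψ.fn x) * ⟪u x, φ.grad x⟫ +
    T n (φ.fn x) * deriv b (ψ.fn x) * ⟪u x, ψ.grad x⟫
  have hzero : ∀ n, ∫ x in Ω, F n x = 0 := by
    intro n
    obtain ⟨χ, hχ⟩ := H1.exists_mul_comp hΩ φ ψ (contDiff_arctanTrunc ((n : ℝ) + 1)) hb
      (M := ((n : ℝ) + 1) * 2) (L := max 1 L) (abs_arctanTrunc_le (hN n))
      (fun z => (hb1 z).trans (by have : (0 : ℝ) ≤ n := n.cast_nonneg; linarith))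
      (fun z => (abs_deriv_arctanTrunc_le (hN n).ne' z).trans (le_max_left _ _))
      (fun z => (hbL z).trans (le_max_right _ _))
    rw [← integral_inner_grad_eq_zero_of_mem_solenoidal hΩ hu χ]
    refine integral_congr_ae ?_
    filter_upwards [hχ] with x hx
    rw [hx, inner_add_right, real_inner_smul_right, real_inner_smul_right]
  have hmeas : ∀ n, AEStronglyMeasurable (F n) (vol Ω) := fun n =>
    ((((hT'c n).comp_aestronglyMeasurable mφ.1).mul
      (hb.continuous.comp_aestronglyMeasurable mψ.1)).mul
        ((Lp.aestronglyMeasurable u).inner (Lp.aestronglyMeasurable φ.grad))).add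
    ((((hTc n).comp_aestronglyMeasurable mφ.1).mul
      (hbc.comp_aestronglyMeasurable mψ.1)).mul
        ((Lp.aestronglyMeasurable u).inner (Lp.aestronglyMeasurable ψ.grad)))
  have hb1i : Integrable (fun x => ‖u x‖ * ‖φ.grad x‖) (vol Ω) :=
    (Lp.memLp u).norm.integrable_mul (Lp.memLp φ.grad).norm
  have hb2i : Integrable (fun x => ‖φ.fn x • u x‖ * ‖ψ.grad x‖) (vol Ω) :=
    hφu.norm.integrable_mul (Lp.memLp ψ.grad).norm
  have hlim := tendsto_integral_of_dominated_convergence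
    (f := fun x => b (ψ.fn x) * ⟪u x, φ.grad x⟫ +
      deriv b (ψ.fn x) * ⟪φ.fn x • u x, ψ.grad x⟫)
    (fun x => ‖u x‖ * ‖φ.grad x‖ + L * (‖φ.fn x • u x‖ * ‖ψ.grad x‖)) hmeas
    (hb1i.add (hb2i.const_mul L)) (fun n => .of_forall fun x => ?_) (.of_forall fun x => ?_)
  · simp_rw [hzero] at hlim
    exact (tendsto_nhds_unique tendsto_const_nhds hlim).symm
  · refine (norm_add_le _ _).trans (add_le_add ?_ ?_)
    · rw [norm_mul, norm_mul]
      calc _ ≤ 1 * 1 * (‖u x‖ * ‖φ.grad x‖) := by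
            gcongr
            exacts [abs_deriv_arctanTrunc_le (hN n).ne' _, hb1 _, abs_real_inner_le_norm _ _]
        _ = _ := by ring
    · rw [norm_mul, norm_mul, norm_smul]
      calc _ ≤ ‖φ.fn x‖ * L * (‖u x‖ * ‖ψ.grad x‖) := by
            gcongr
            exacts [abs_arctanTrunc_le_abs (hN n).ne' _, hbL _, abs_real_inner_le_norm _ _]
        _ = _ := by ring
  · have h1 := ((tendsto_deriv_arctanTrunc (φ.fn x)).mul_const (b (ψ.fn x))).mul_const
      ⟪u x, φ.grad x⟫
    have h2 := ((tendsto_arctanTrunc (φ.fn x)).mul_const (deriv b (ψ.fn x))).mul_const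
      ⟪u x, ψ.grad x⟫
    refine (h1.add h2).trans (le_of_eq ?_)
    rw [real_inner_smul_left]
    congr 1
    ring

/-- The convection term tested with `χ = b(ψ)` is controlled by the distance from `φ` to `ψ`. Indeed
`∫ φ u · ∇b(ψ) = -∫ b(ψ) u · ∇φ = ∫ b(ψ) u · ∇(ψ - φ)`, since `b(ψ) u · ∇ψ = u · ∇B(ψ)` integrates
to zero; all derivatives of `b` have disappeared. Only `‖u‖` in `L²(Ω)^d` enters. -/
theorem abs_integral_convection_le (hΩ : IsOpen Ω) [IsFiniteMeasure (vol Ω)] {u : L2vec Ω}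
    (hu : u ∈ solenoidal Ω) (φ ψ : H1 Ω) {b B : ℝ → ℝ} (hb : ContDiff ℝ 1 b)
    (hB : ∀ s, HasDerivAt B (b s) s)
    {L : ℝ} (hb1 : ∀ s, |b s| ≤ 1) (hbL : ∀ s, |deriv b s| ≤ L)
    (hφu : MemLp (fun x => φ.fn x • u x) 2 (vol Ω)) {χ : H1 Ω}
    (hχ : ∀ᵐ x ∂(vol Ω), χ.grad x = deriv b (ψ.fn x) • ψ.grad x) :
    |∫ x in Ω, ⟪φ.fn x • u x, χ.grad x⟫| ≤ ‖u‖ * ‖φ - ψ‖ := by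
  have hu1 := integral_convection_add_eq_zero hΩ hu φ ψ hb hb1 hbL hφu
  have hBd : deriv B = b := funext fun s => (hB s).deriv
  obtain ⟨ξ, -, hξ⟩ := H1.exists_comp hΩ ψ (p := B)
    (contDiff_one_iff_deriv.2 ⟨fun s => (hB s).differentiableAt, hBd ▸ hb.continuous⟩)
    (L := 1) (by rw [hBd]; exact hb1)
  have hu2 := integral_inner_grad_eq_zero_of_mem_solenoidal hΩ hu ξ
  have hi : ∀ ζ : H1 Ω, Integrable (fun x => b (ψ.fn x) * ⟪u x, ζ.grad x⟫) (vol Ω) := fun ζ =>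
    (MemLp.integrable_mul (p := 2) (q := 2) (Lp.memLp u).norm (Lp.memLp ζ.grad).norm).mono
      ((hb.continuous.comp_aestronglyMeasurable (Lp.aestronglyMeasurable ψ.fn)).mul
        ((Lp.aestronglyMeasurable u).inner (Lp.aestronglyMeasurable ζ.grad)))
      (.of_forall fun x => by
        rw [norm_mul, Pi.mul_apply, norm_mul, norm_norm, norm_norm]
        calc _ ≤ 1 * (‖u x‖ * ‖ζ.grad x‖) := by
              gcongr
              exacts [hb1 _, abs_real_inner_le_norm _ _]
          _ = _ := one_mul _)
  have hi2 : Integrable (fun x => deriv b (ψ.fn x) * ⟪φ.fn x • u x, ψ.grad x⟫) (vol Ω) := by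
    have := hφu.norm.integrable_mul (Lp.memLp χ.grad).norm
    refine this.mono ((hb.continuous_deriv le_rfl).comp_aestronglyMeasurable
      (Lp.aestronglyMeasurable ψ.fn) |>.mul (hφu.1.inner (Lp.aestronglyMeasurable ψ.grad))) ?_
    filter_upwards [hχ] with x hx
    rw [← real_inner_smul_right, ← hx, Pi.mul_apply, norm_mul, norm_norm, norm_norm]
    exact abs_real_inner_le_norm _ _
  have e1 : ∫ x in Ω, ⟪φ.fn x • u x, χ.grad x⟫ =
      ∫ x in Ω, deriv b (ψ.fn x) * ⟪φ.fn x • u x, ψ.grad x⟫ := by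
    refine integral_congr_ae ?_
    filter_upwards [hχ] with x hx
    rw [hx, real_inner_smul_right]
  have e2 : ∫ x in Ω, b (ψ.fn x) * ⟪u x, ψ.grad x⟫ = 0 := by
    rw [← hu2]
    refine integral_congr_ae ?_
    filter_upwards [hξ] with x hx
    rw [hx, hBd, real_inner_smul_right]
  rw [integral_add (hi φ) hi2] at hu1
  have e3 : ∫ x in Ω, ⟪φ.fn x • u x, χ.grad x⟫ =
      -∫ x in Ω, b (ψ.fn x) * ⟪u x, (φ - ψ).grad x⟫ := by
    have e4 : ∫ x in Ω, b (ψ.fn x) * ⟪u x, (φ - ψ).grad x⟫ =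
        ∫ x in Ω, (b (ψ.fn x) * ⟪u x, φ.grad x⟫ - b (ψ.fn x) * ⟪u x, ψ.grad x⟫) := by
      refine integral_congr_ae ?_
      rw [H1.grad_sub]
      filter_upwards [Lp.coeFn_sub φ.grad ψ.grad] with x hx
      rw [hx, Pi.sub_apply, inner_sub_right, mul_sub]
    rw [e4, integral_sub (hi φ) (hi ψ), e2, e1]
    linarith
  rw [e3, abs_neg]
  have := abs_integral_le_of_ae_le_norm_mul_norm u (φ - ψ).grad zero_le_one
    (F := fun x => b (ψ.fn x) * ⟪u x, (φ - ψ).grad x⟫) (.of_forall fun x => by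
      rw [abs_mul]
      gcongr
      exacts [hb1 _, abs_real_inner_le_norm _ _])
  rw [one_mul] at this
  exact this.trans (by gcongr; exact H1.norm_grad_le _)

end H1

/-! ### Penalties for the values outside an interval -/

/-- A convex function `B` of class `C²` penalising the values outside `[0, M]`, with derivative `b`:
`B` is nonnegative and vanishes on `[0, M]`, and `b` is nondecreasing, bounded and Lipschitz, with
`b 0 = 0`. -/
structure IsPenalty (M : ℝ) (b B : ℝ → ℝ) : Prop where
  contDiff : ContDiff ℝ 1 b
  abs_le : ∀ s, |b s| ≤ 1
  deriv_nonneg : ∀ s, 0 ≤ deriv b s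
  deriv_le : ∀ s, deriv b s ≤ 2
  zero : b 0 = 0
  hasDerivAt : ∀ s, HasDerivAt B (b s) s
  nonneg : ∀ s, 0 ≤ B s
  eq_zero : ∀ s, 0 ≤ s → s ≤ M → B s = 0

namespace IsPenalty

variable {M : ℝ} {b B : ℝ → ℝ}

theorem abs_deriv_le (h : IsPenalty M b B) (s : ℝ) : |deriv b s| ≤ 2 := by
  rw [abs_of_nonneg (h.deriv_nonneg s)]
  exact h.deriv_le s

theorem monotone (h : IsPenalty M b B) : Monotone b :=
  monotone_of_deriv_nonneg (h.contDiff.differentiable one_ne_zero) h.deriv_nonneg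

theorem mul_nonneg (h : IsPenalty M b B) (s : ℝ) : 0 ≤ s * b s := by
  rcases le_total 0 s with hs | hs
  · exact _root_.mul_nonneg hs (h.zero ▸ h.monotone hs)
  · exact mul_nonneg_of_nonpos_of_nonpos hs (h.zero ▸ h.monotone hs)

theorem abs_le_two_mul (h : IsPenalty M b B) (s : ℝ) : |b s| ≤ 2 * |s| := by
  have := convex_univ.norm_image_sub_le_of_norm_deriv_le (f := b) (C := 2) (x := 0) (y := s)
    (fun x _ => (h.contDiff.differentiable one_ne_zero).differentiableAt)
    (fun x _ => h.abs_deriv_le x) (mem_univ _) (mem_univ _)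
  simpa [h.zero] using this

theorem abs_sub_le (h : IsPenalty M b B) (s t : ℝ) : |B s - B t| ≤ |s - t| := by
  have := convex_univ.norm_image_sub_le_of_norm_hasDerivWithin_le (f := B) (C := 1) (x := t)
    (y := s) (fun x _ => (h.hasDerivAt x).hasDerivWithinAt) (fun x _ => h.abs_le x)
    (mem_univ _) (mem_univ _)
  simpa using this

theorem continuous (h : IsPenalty M b B) : Continuous B :=
  continuous_iff_continuousAt.2 fun s => (h.hasDerivAt s).continuousAt

/-- The tangent inequality of the convex function `B`. -/
theorem sub_le (h : IsPenalty M b B) (s t : ℝ) : B t - B s ≤ b t * (t - s) := by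
  have hd : deriv B = b := funext fun s => (h.hasDerivAt s).deriv
  have hconv : ConvexOn ℝ univ B := by
    refine MonotoneOn.convexOn_of_deriv convex_univ h.continuous.continuousOn
      (fun x _ => (h.hasDerivAt x).differentiableAt.differentiableWithinAt) ?_
    rw [hd]
    exact h.monotone.monotoneOn _
  rcases lt_trichotomy s t with hst | hst | hst
  · have := hconv.slope_le_of_hasDerivAt (mem_univ s) (mem_univ t) hst (h.hasDerivAt t)
    rw [slope_def_field, div_le_iff₀ (by linarith)] at this
    exact this
  · simp [hst]
  · have := hconv.le_slope_of_hasDerivAt (mem_univ t) (mem_univ s) hst (h.hasDerivAt t)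
    rw [slope_def_field, le_div_iff₀ (by linarith)] at this
    linarith

end IsPenalty

/-- The model one-sided penalty derivative `s ↦ s₊² / (1 + s₊²)`. -/
noncomputable def posPenaltyDeriv (s : ℝ) : ℝ := max s 0 ^ 2 / (1 + max s 0 ^ 2)

/-- The one-sided penalty, the primitive of `posPenaltyDeriv` that vanishes on `(-∞, 0]`. -/
noncomputable def posPenalty (s : ℝ) : ℝ := ∫ r in (0 : ℝ)..s, posPenaltyDeriv r

theorem hasDerivAt_max_zero_sq (s : ℝ) :
    HasDerivAt (fun s : ℝ => max s 0 ^ 2) (2 * max s 0) s := by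
  rcases lt_trichotomy s 0 with hs | rfl | hs
  · rw [max_eq_right hs.le, mul_zero]
    refine (hasDerivAt_const s (0 : ℝ)).congr_of_eventuallyEq ?_
    filter_upwards [Iio_mem_nhds hs] with x hx
    simp [max_eq_right (mem_Iio.1 hx).le]
  · rw [max_self, mul_zero, ← hasDerivWithinAt_univ, ← Iic_union_Ici (a := (0 : ℝ))]
    refine HasDerivWithinAt.union ?_ ?_
    · exact (hasDerivWithinAt_const (0 : ℝ) (Iic 0) (0 : ℝ)).congr
        (fun x hx => by simp [max_eq_right (mem_Iic.1 hx)]) (by simp)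
    · have h := (hasDerivAt_pow 2 (0 : ℝ)).hasDerivWithinAt (s := Ici 0)
      norm_num at h
      exact h.congr (fun x hx => by simp [max_eq_left (mem_Ici.1 hx)]) (by simp)
  · rw [max_eq_left hs.le]
    have h := hasDerivAt_pow 2 s
    norm_num at h
    refine h.congr_of_eventuallyEq ?_
    filter_upwards [Ioi_mem_nhds hs] with x hx
    simp [max_eq_left (mem_Ioi.1 hx).le]

theorem hasDerivAt_posPenaltyDeriv (s : ℝ) :
    HasDerivAt posPenaltyDeriv (2 * max s 0 / (1 + max s 0 ^ 2) ^ 2) s := by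
  have h := (hasDerivAt_max_zero_sq s).div ((hasDerivAt_max_zero_sq s).const_add 1)
    (by positivity)
  refine h.congr_deriv ?_
  congr 1
  ring

theorem deriv_posPenaltyDeriv :
    deriv posPenaltyDeriv = fun s => 2 * max s 0 / (1 + max s 0 ^ 2) ^ 2 :=
  funext fun s => (hasDerivAt_posPenaltyDeriv s).deriv

theorem contDiff_posPenaltyDeriv : ContDiff ℝ 1 posPenaltyDeriv := by
  refine contDiff_one_iff_deriv.2 ⟨fun s => (hasDerivAt_posPenaltyDeriv s).differentiableAt, ?_⟩
  rw [deriv_posPenaltyDeriv]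
  exact Continuous.div (by fun_prop) (by fun_prop) fun s => by positivity

theorem deriv_posPenaltyDeriv_nonneg (s : ℝ) : 0 ≤ deriv posPenaltyDeriv s := by
  rw [deriv_posPenaltyDeriv]
  positivity

theorem deriv_posPenaltyDeriv_le (s : ℝ) : deriv posPenaltyDeriv s ≤ 2 := by
  rw [deriv_posPenaltyDeriv]
  have : 0 ≤ max s 0 := le_max_right _ _
  beta_reduce
  rw [div_le_iff₀ (by positivity)]
  nlinarith [sq_nonneg (max s 0 - 1), sq_nonneg (max s 0 ^ 2)]

theorem abs_posPenaltyDeriv_le (s : ℝ) : |posPenaltyDeriv s| ≤ 1 := by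
  rw [posPenaltyDeriv, abs_of_nonneg (by positivity), div_le_one (by positivity)]
  linarith

theorem posPenaltyDeriv_of_nonpos {s : ℝ} (hs : s ≤ 0) : posPenaltyDeriv s = 0 := by
  simp [posPenaltyDeriv, max_eq_right hs]

theorem posPenaltyDeriv_pos {s : ℝ} (hs : 0 < s) : 0 < posPenaltyDeriv s := by
  rw [posPenaltyDeriv, max_eq_left hs.le]
  positivity

theorem hasDerivAt_posPenalty (s : ℝ) : HasDerivAt posPenalty (posPenaltyDeriv s) s :=
  intervalIntegral.integral_hasDerivAt_right
    (contDiff_posPenaltyDeriv.continuous.intervalIntegrable _ _)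
    (contDiff_posPenaltyDeriv.continuous.stronglyMeasurableAtFilter _ _)
    contDiff_posPenaltyDeriv.continuous.continuousAt

theorem posPenalty_of_nonpos {s : ℝ} (hs : s ≤ 0) : posPenalty s = 0 := by
  rw [posPenalty, intervalIntegral.integral_symm, intervalIntegral.integral_of_le hs,
    setIntegral_eq_zero_of_forall_eq_zero fun x hx => posPenaltyDeriv_of_nonpos hx.2, neg_zero]

theorem posPenalty_pos {s : ℝ} (hs : 0 < s) : 0 < posPenalty s :=
  intervalIntegral.intervalIntegral_pos_of_pos_on
    (contDiff_posPenaltyDeriv.continuous.intervalIntegrable _ _)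
    (fun _ hx => posPenaltyDeriv_pos hx.1) hs

theorem posPenalty_nonneg (s : ℝ) : 0 ≤ posPenalty s := by
  rcases le_or_gt s 0 with hs | hs
  exacts [(posPenalty_of_nonpos hs).ge, (posPenalty_pos hs).le]

theorem nonpos_of_posPenalty_eq_zero {s : ℝ} (hs : posPenalty s = 0) : s ≤ 0 :=
  not_lt.1 fun h => (posPenalty_pos h).ne' hs

theorem isPenalty_upper {M : ℝ} (hM : 0 ≤ M) :
    IsPenalty M (fun s => posPenaltyDeriv (s - M)) (fun s => posPenalty (s - M)) where
  contDiff := contDiff_posPenaltyDeriv.comp (contDiff_id.sub contDiff_const)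
  abs_le _ := abs_posPenaltyDeriv_le _
  deriv_nonneg s := by
    rw [deriv_comp_sub_const]
    exact deriv_posPenaltyDeriv_nonneg _
  deriv_le s := by
    rw [deriv_comp_sub_const]
    exact deriv_posPenaltyDeriv_le _
  zero := posPenaltyDeriv_of_nonpos (by linarith)
  hasDerivAt s := (hasDerivAt_posPenalty (s - M)).comp_sub_const s M
  nonneg _ := posPenalty_nonneg _
  eq_zero _ _ h := posPenalty_of_nonpos (by linarith)

theorem isPenalty_lower (M : ℝ) :
    IsPenalty M (fun s => -posPenaltyDeriv (-s)) (fun s => posPenalty (-s)) where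
  contDiff := (contDiff_posPenaltyDeriv.comp contDiff_neg).neg
  abs_le s := by
    rw [abs_neg]
    exact abs_posPenaltyDeriv_le _
  deriv_nonneg s := by
    rw [deriv.fun_neg, deriv_comp_neg, neg_neg]
    exact deriv_posPenaltyDeriv_nonneg _
  deriv_le s := by
    rw [deriv.fun_neg, deriv_comp_neg, neg_neg]
    exact deriv_posPenaltyDeriv_le _
  zero := by
    rw [posPenaltyDeriv_of_nonpos (by simp), neg_zero]
  hasDerivAt s := by
    have := (hasDerivAt_posPenalty (-s)).comp s (hasDerivAt_neg s)
    simpa [Function.comp_def] using this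
  nonneg _ := posPenalty_nonneg _
  eq_zero _ h _ := posPenalty_of_nonpos (by linarith)

/-! ### The transport equation tested with a penalty -/

theorem IsBoundedLipschitzDomain.isFiniteMeasure {d : ℕ} {Ω : Set (E d)}
    (h : IsBoundedLipschitzDomain Ω) : IsFiniteMeasure (vol Ω) :=
  ⟨by rw [Measure.restrict_apply_univ]; exact h.2.2.1.measure_lt_top⟩

theorem Medium.exists_bound_κ {d : ℕ} (P : Medium d) :
    ∃ K : ℝ, 0 ≤ K ∧ ∀ᵐ x ∂(vol P.Ω), |P.κ x| ≤ K := by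
  refine ⟨(eLpNormEssSup P.κ (vol P.Ω)).toReal, ENNReal.toReal_nonneg, ?_⟩
  have hfin : eLpNormEssSup P.κ (vol P.Ω) ≠ ⊤ := by
    have := P.κ_mem.2.ne
    rwa [eLpNorm_exponent_top] at this
  filter_upwards [ae_le_eLpNormEssSup (f := P.κ) (μ := vol P.Ω)] with x hx
  have := ENNReal.toReal_mono hfin hx
  simpa using this

/-- The time derivative `w = ∂c/∂t` at one time, tested with `χ = b(ψ)` where `ψ` is the
concentration at another time, is nonpositive up to an error proportional to the distance
`‖φ - ψ‖` between the concentrations at the two times. For `φ = ψ` this is the formal computation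
behind the maximum principle: the diffusion and reaction terms are monotone and the convection
term vanishes. The error involves only the `L²` norm of `u` and `H¹` norms of the concentration,
all of them square-integrable in time. -/
theorem pair_penalty_le {d : ℕ} (P : Medium d) {s : ℝ} (hs : |s| ≤ 1) {M : ℝ} {b B : ℝ → ℝ}
    (hb : IsPenalty M b B) {K : ℝ} (hK : 0 ≤ K) (hκ : ∀ᵐ x ∂(vol P.Ω), |P.κ x| ≤ K)
    {u : L2vec P.Ω} (hu : u ∈ solenoidal P.Ω) {c : E d → ℝ} {φ ψ χ : H1 P.Ω} {w : H1dual P.Ω}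
    (hc : ∀ᵐ x ∂(vol P.Ω), φ.fn x = c x)
    (hflux : MemLp (fun x => c x • u x) 2 (vol P.Ω))
    (heq : ∀ ζ : H1 P.Ω, (1 + P.k) * w.pair ζ + s * (∫ x in P.Ω, ⟪c x • u x, ζ.grad x⟫) +
      P.D * (∫ x in P.Ω, ⟪φ.grad x, ζ.grad x⟫) + ∫ x in P.Ω, P.κ x * c x * ζ.fn x = 0)
    (hχ : ∀ᵐ x ∂(vol P.Ω), χ.fn x = b (ψ.fn x))
    (hχ' : ∀ᵐ x ∂(vol P.Ω), χ.grad x = deriv b (ψ.fn x) • ψ.grad x) :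
    w.pair χ ≤ (1 + 2 * P.D + 2 * K) * ((‖u‖ + ‖ψ‖) * ‖φ - ψ‖) := by
  have hfin := P.domain.isFiniteMeasure
  have hflux' : MemLp (fun x => φ.fn x • u x) 2 (vol P.Ω) := by
    refine hflux.ae_eq ?_
    filter_upwards [hc] with x hx
    rw [hx]
  have h1 : |∫ x in P.Ω, ⟪c x • u x, χ.grad x⟫| ≤ ‖u‖ * ‖φ - ψ‖ := by
    have := abs_integral_convection_le P.domain.1 hu φ ψ hb.contDiff hb.hasDerivAt hb.abs_le
      hb.abs_deriv_le hflux' hχ'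
    rwa [integral_congr_ae (g := fun x => ⟪c x • u x, χ.grad x⟫)
      (by filter_upwards [hc] with x hx; rw [hx])] at this
  have hng : ‖ψ.grad‖ ≤ ‖ψ‖ := ψ.norm_grad_le
  have hnf : ‖ψ.fn‖ ≤ ‖ψ‖ := ψ.norm_fn_le
  -- the diffusion term is monotone in `ψ`, up to the increment `φ - ψ`
  have h2 : -(2 * (‖φ - ψ‖ * ‖ψ‖)) ≤ ∫ x in P.Ω, ⟪φ.grad x, χ.grad x⟫ := by
    have hi : Integrable (fun x => ⟪φ.grad x, χ.grad x⟫) (vol P.Ω) := L2.integrable_inner _ _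
    have hi2 : Integrable (fun x => ⟪(φ - ψ).grad x, χ.grad x⟫) (vol P.Ω) :=
      L2.integrable_inner _ _
    have h3 := abs_integral_le_of_ae_le_norm_mul_norm (φ - ψ).grad ψ.grad zero_le_two
      (F := fun x => ⟪(φ - ψ).grad x, χ.grad x⟫) (by
        filter_upwards [hχ'] with x hx
        rw [hx, real_inner_smul_right, abs_mul]
        gcongr
        exacts [hb.abs_deriv_le _, abs_real_inner_le_norm _ _])
    have h4 : ∫ x in P.Ω, ⟪(φ - ψ).grad x, χ.grad x⟫ ≤ ∫ x in P.Ω, ⟪φ.grad x, χ.grad x⟫ := by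
      refine integral_mono_ae hi2 hi ?_
      rw [H1.grad_sub]
      filter_upwards [hχ', Lp.coeFn_sub φ.grad ψ.grad] with x hx hx'
      rw [hx', Pi.sub_apply, inner_sub_left, sub_le_self_iff, hx, real_inner_smul_right,
        real_inner_self_eq_norm_sq]
      exact mul_nonneg (hb.deriv_nonneg _) (sq_nonneg _)
    have h5 : ‖(φ - ψ).grad‖ * ‖ψ.grad‖ ≤ ‖φ - ψ‖ * ‖ψ‖ := by
      gcongr
      exact H1.norm_grad_le _
    linarith [(abs_le.1 h3).1]
  have h6 : -(K * 2 * (‖φ - ψ‖ * ‖ψ‖)) ≤ ∫ x in P.Ω, P.κ x * c x * χ.fn x := by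
    have hmκ := P.κ_mem.1
    have hi : ∀ ζ : H1 P.Ω, Integrable (fun x => P.κ x * (ζ.fn x * χ.fn x)) (vol P.Ω) :=
      fun ζ => (MemLp.integrable_mul (p := 2) (q := 2) (Lp.memLp ζ.fn)
        (Lp.memLp χ.fn)).bdd_mul hmκ hκ
    have h3 := abs_integral_le_of_ae_le_norm_mul_norm (φ - ψ).fn ψ.fn
      (mul_nonneg hK zero_le_two)
      (F := fun x => P.κ x * ((φ - ψ).fn x * χ.fn x)) (by
        filter_upwards [hχ, hκ] with x hx hx'
        rw [hx, abs_mul, abs_mul]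
        calc _ ≤ K * (|(φ - ψ).fn x| * (2 * |ψ.fn x|)) := by
              gcongr
              exact hb.abs_le_two_mul _
          _ = _ := by simp only [Real.norm_eq_abs]; ring)
    have h4 : ∫ x in P.Ω, P.κ x * ((φ - ψ).fn x * χ.fn x) ≤
        ∫ x in P.Ω, P.κ x * c x * χ.fn x := by
      rw [integral_congr_ae (f := fun x => P.κ x * c x * χ.fn x)
        (g := fun x => P.κ x * (φ.fn x * χ.fn x))
        (by filter_upwards [hc] with x hx; rw [hx]; ring)]
      refine integral_mono_ae (hi _) (hi _) ?_
      rw [H1.fn_sub]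
      filter_upwards [hχ, Lp.coeFn_sub φ.fn ψ.fn, P.κ_ge] with x hx hx' hx''
      rw [hx', Pi.sub_apply, hx]
      refine mul_le_mul_of_nonneg_left ?_ (P.κ₁_pos.le.trans hx'')
      rw [sub_mul, sub_le_self_iff]
      exact hb.mul_nonneg _
    have h5 : ‖(φ - ψ).fn‖ * ‖ψ.fn‖ ≤ ‖φ - ψ‖ * ‖ψ‖ := by
      gcongr
      exact H1.norm_fn_le _
    have h7 : K * 2 * (‖(φ - ψ).fn‖ * ‖ψ.fn‖) ≤ K * 2 * (‖φ - ψ‖ * ‖ψ‖) := by gcongr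
    linarith [(abs_le.1 h3).1]
  have h8 := heq χ
  set I := ∫ x in P.Ω, ⟪c x • u x, χ.grad x⟫
  have h9 : |s * I| ≤ 1 * (‖u‖ * ‖φ - ψ‖) := by
    rw [abs_mul]
    gcongr
  have h10 := mul_le_mul_of_nonneg_left h2 P.D_pos.le
  set A := (1 + 2 * P.D + 2 * K) * ((‖u‖ + ‖ψ‖) * ‖φ - ψ‖) with hA
  have hD := P.D_pos
  have hA0 : 0 ≤ A := by positivity
  have h11 : (1 + P.k) * w.pair χ ≤ A := by
    have e1 : 0 ≤ ‖ψ‖ * ‖φ - ψ‖ := by positivity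
    have e2 : 0 ≤ (2 * P.D + 2 * K) * (‖u‖ * ‖φ - ψ‖) := by positivity
    rw [hA]
    linarith [(abs_le.1 h9).1]
  by_contra hlt
  rw [not_le] at hlt
  nlinarith [P.k_nonneg]

/-! ### Monotonicity from estimates of increments -/

theorem ofReal_integral_le_lintegral_ofReal {α : Type*} [MeasurableSpace α] {μ : Measure α}
    {f : α → ℝ} (hf : Integrable f μ) :
    ENNReal.ofReal (∫ x, f x ∂μ) ≤ ∫⁻ x, ENNReal.ofReal (f x) ∂μ := by
  rw [integral_eq_lintegral_pos_part_sub_lintegral_neg_part hf]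
  refine (ENNReal.ofReal_le_ofReal (sub_le_self _ ENNReal.toReal_nonneg)).trans ?_
  exact ENNReal.ofReal_toReal_le

/-- A function whose increments satisfy `e(b) - e(a) ≤ K ∫_a^b (U(τ) + V(b)) ‖C(τ) - C(b)‖ dτ`,
with `U`, `V` and `C` square-integrable, is nonincreasing off a null set. No continuity of `e` is
assumed: the increments over intervals of length `h` are integrated over `(a, b)` and divided by
`h`. By the Cauchy–Schwarz inequality the right-hand side is at most a constant times the `L²`
modulus of continuity of `C` at `h`, and by Lebesgue's differentiation theorem the left-hand side
converges to `e(b) - e(a)`. -/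
theorem le_of_increment_le_lintegral {X : Type*} [NormedAddCommGroup X] {C : ℝ → X}
    (hC : MemLp C 2 volume) {U V : ℝ → ℝ≥0∞} (hU : AEMeasurable U volume)
    (hV : AEMeasurable V volume) (hU2 : ∫⁻ t, U t ^ (2 : ℝ) ≠ ⊤) (hV2 : ∫⁻ t, V t ^ (2 : ℝ) ≠ ⊤)
    {e : ℝ → ℝ} (he : LocallyIntegrable e volume) {K : ℝ≥0∞} (hK : K ≠ ⊤) {G : Set ℝ}
    (hG : ∀ᵐ t, 0 < t → t ∈ G)
    (hinc : ∀ a ∈ G, ∀ b ∈ G, a < b → ENNReal.ofReal (e b - e a) ≤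
      K * ∫⁻ τ in Ioc a b, (U τ + V b) * ‖C τ - C b‖ₑ) :
    ∃ G' ⊆ G, (∀ᵐ t, 0 < t → t ∈ G') ∧ ∀ a ∈ G', 0 < a → ∀ b ∈ G', a < b → e b ≤ e a := by
  refine ⟨G ∩ {x | ∀ c, HasDerivAt (fun x => ∫ t in c..x, e t) (e x) x}, inter_subset_left, ?_, ?_⟩
  · filter_upwards [hG, LocallyIntegrable.ae_hasDerivAt_integral he] with t h1 h2 h3
    exact ⟨h1 h3, h2⟩
  rintro a ⟨haG, ha⟩ ha0 b ⟨hbG, hb⟩ hab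
  set F : ℝ → ℝ := fun x => ∫ t in (0 : ℝ)..x, e t with hF
  have hei : ∀ x y, IntervalIntegrable e volume x y := fun x y =>
    intervalIntegrable_iff.2 ((he.integrableOn_isCompact isCompact_uIcc).mono_set
      uIoc_subset_uIcc)
  set N : ℝ≥0∞ := (∫⁻ t, U t ^ (2 : ℝ)) ^ (1 / 2 : ℝ) + (∫⁻ t, V t ^ (2 : ℝ)) ^ (1 / 2 : ℝ) with hN
  have hNtop : N ≠ ⊤ := by
    simp only [hN, ne_eq, ENNReal.add_eq_top, not_or]
    exact ⟨ENNReal.rpow_ne_top_of_nonneg (by norm_num) hU2,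
      ENNReal.rpow_ne_top_of_nonneg (by norm_num) hV2⟩
  set modC : ℝ → ℝ≥0∞ := fun σ => eLpNorm (fun t => C (σ + t) - C t) 2 volume with hmod
  have hm0 : Tendsto modC (𝓝 0) (𝓝 0) :=
    tendsto_eLpNorm_translate_sub one_le_two ENNReal.ofNat_ne_top hC
  have hCτ : ∀ σ, AEStronglyMeasurable (fun t => C (σ + t)) volume := fun σ =>
    hC.1.comp_measurePreserving (measurePreserving_add_left volume σ)
  -- Cauchy–Schwarz for each shift
  have hshift : ∀ σ, ∫⁻ t, (U (σ + t) + V t) * ‖C (σ + t) - C t‖ₑ ≤ N * modC σ := by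
    intro σ
    have hm : AEMeasurable (fun t => ‖C (σ + t) - C t‖ₑ) volume := ((hCτ σ).sub hC.1).enorm
    have hUσ : AEMeasurable (fun t => U (σ + t)) volume :=
      hU.comp_quasiMeasurePreserving
        (measurePreserving_add_left volume σ).quasiMeasurePreserving
    have hme : (∫⁻ t, ‖C (σ + t) - C t‖ₑ ^ (2 : ℝ)) ^ (1 / 2 : ℝ) = modC σ := by
      simp only [hmod]
      rw [eLpNorm_eq_lintegral_rpow_enorm_toReal (by norm_num) (by norm_num)]
      simp
    have hpq : Real.HolderConjugate 2 2 := Real.HolderConjugate.two_two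
    have h1 := ENNReal.lintegral_mul_le_Lp_mul_Lq volume hpq hUσ hm
    have h2 := ENNReal.lintegral_mul_le_Lp_mul_Lq volume hpq hV hm
    rw [hme] at h1 h2
    rw [lintegral_add_left_eq_self (fun t => U t ^ (2 : ℝ)) σ] at h1
    simp_rw [add_mul]
    refine (lintegral_add_left' (hUσ.mul hm) _).le.trans ?_
    rw [hN, add_mul]
    exact add_le_add h1 h2
  have hbound : ∀ h : ℝ, 0 < h → ∀ ε : ℝ≥0∞, (∀ σ, |σ| ≤ h → modC σ ≤ ε) →
      ENNReal.ofReal ((F (b + h) - F b) - (F (a + h) - F a)) ≤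
        ENNReal.ofReal h * (K * (N * ε)) := by
    intro h hh ε hε
    have heh : IntervalIntegrable (fun t => e (t + h)) volume a b := by
      simpa using (hei (a + h) (b + h)).comp_add_right h
    have e1 : (F (b + h) - F b) - (F (a + h) - F a) = ∫ t in a..b, (e (t + h) - e t) := by
      rw [intervalIntegral.integral_sub heh (hei a b), intervalIntegral.integral_comp_add_right]
      simp only [hF]
      rw [← intervalIntegral.integral_interval_sub_left (hei 0 (b + h)) (hei 0 (a + h)),
        ← intervalIntegral.integral_interval_sub_left (hei 0 b) (hei 0 a)]
      ring
    have hint : IntegrableOn (fun t => e (t + h) - e t) (Ioc a b) := (heh.sub (hei a b)).1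
    have hGh : ∀ᵐ t, 0 < t + h → t + h ∈ G :=
      (measurePreserving_add_right volume h).quasiMeasurePreserving.ae hG
    rw [e1, intervalIntegral.integral_of_le hab.le]
    have hmeas : AEMeasurable (Function.uncurry fun t σ => (U (σ + t) + V t) * ‖C (σ + t) - C t‖ₑ)
        (volume.prod (volume.restrict (Ioc (-h) 0))) := by
      have hac : (volume.prod (volume.restrict (Ioc (-h) 0)) : Measure (ℝ × ℝ)) ≪
          volume.prod volume :=
        Measure.AbsolutelyContinuous.rfl.prod Measure.restrict_le_self.absolutelyContinuous
      have hq : Measure.QuasiMeasurePreserving (fun z : ℝ × ℝ => z.2 + z.1)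
          (volume.prod volume) volume := by
        simpa only [add_comm] using quasiMeasurePreserving_add (volume : Measure ℝ) volume
      refine AEMeasurable.mono_ac ?_ hac
      exact ((hU.comp_quasiMeasurePreserving hq).add hV.comp_fst).mul
        ((hC.1.comp_quasiMeasurePreserving hq).sub hC.1.comp_fst).enorm
    -- substitute `τ = t + h + σ`, enlarge `(a, b)` to the line, and exchange the integrals
    calc ENNReal.ofReal (∫ t in Ioc a b, (e (t + h) - e t))
        ≤ ∫⁻ t in Ioc a b, ENNReal.ofReal (e (t + h) - e t) :=
          ofReal_integral_le_lintegral_ofReal hint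
      _ ≤ ∫⁻ t in Ioc a b, K * ∫⁻ σ in Ioc (-h) 0,
            (U (σ + (t + h)) + V (t + h)) * ‖C (σ + (t + h)) - C (t + h)‖ₑ := by
          refine lintegral_mono_ae ((ae_restrict_iff' measurableSet_Ioc).2 ?_)
          filter_upwards [hG, hGh] with t h1 h2 h3
          have ht : 0 < t := ha0.trans h3.1
          refine (hinc t (h1 ht) (t + h) (h2 (by linarith)) (by linarith)).trans (le_of_eq ?_)
          congr 1
          have := (measurePreserving_add_right volume (t + h)).setLIntegral_comp_preimage_emb
            (measurableEmbedding_addRight (t + h))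
            (fun τ => (U τ + V (t + h)) * ‖C τ - C (t + h)‖ₑ) (Ioc t (t + h))
          rw [← this]
          congr 2
          ext σ
          simp
      _ ≤ ∫⁻ t, K * ∫⁻ σ in Ioc (-h) 0,
            (U (σ + (t + h)) + V (t + h)) * ‖C (σ + (t + h)) - C (t + h)‖ₑ :=
          setLIntegral_le_lintegral _ _
      _ = ∫⁻ t, K * ∫⁻ σ in Ioc (-h) 0, (U (σ + t) + V t) * ‖C (σ + t) - C t‖ₑ :=
          lintegral_add_right_eq_self (fun t => K * ∫⁻ σ in Ioc (-h) 0,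
            (U (σ + t) + V t) * ‖C (σ + t) - C t‖ₑ) h
      _ = K * ∫⁻ σ in Ioc (-h) 0, ∫⁻ t, (U (σ + t) + V t) * ‖C (σ + t) - C t‖ₑ := by
          rw [lintegral_const_mul' _ _ hK, lintegral_lintegral_swap hmeas]
      _ ≤ K * ∫⁻ σ in Ioc (-h) 0, N * ε := by
          refine mul_le_mul' le_rfl ?_
          refine setLIntegral_mono' measurableSet_Ioc fun σ hσ => (hshift σ).trans ?_
          gcongr
          exact hε σ (abs_le.2 ⟨hσ.1.le, by linarith [hσ.2]⟩)
      _ = ENNReal.ofReal h * (K * (N * ε)) := by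
          rw [setLIntegral_const, Real.volume_Ioc, zero_sub, neg_neg]
          ring
  -- pass to the limit in the difference quotients
  have hquot : Tendsto (fun h : ℝ => h⁻¹ * ((F (b + h) - F b) - (F (a + h) - F a))) (𝓝[>] 0)
      (𝓝 (e b - e a)) := by
    have h1 := (hb 0).tendsto_slope_zero_right
    have h2 := (ha 0).tendsto_slope_zero_right
    refine (h1.sub h2).congr fun h => ?_
    simp only [smul_eq_mul, hF]
    ring
  have hlim : ENNReal.ofReal (e b - e a) ≤ 0 := by
    refine ENNReal.le_of_forall_pos_le_add fun δ hδ _ => ?_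
    rw [zero_add]
    obtain ⟨ε, hε, hεδ⟩ : ∃ ε : ℝ≥0∞, 0 < ε ∧ K * (N * ε) ≤ δ := by
      have hKN : K * N ≠ ⊤ := ENNReal.mul_ne_top hK hNtop
      refine ⟨δ / (K * N + 1), ENNReal.div_pos (by simpa using hδ.ne') (by simp [hKN]), ?_⟩
      rw [← mul_assoc]
      calc _ ≤ (K * N + 1) * (δ / (K * N + 1)) := by
            gcongr
            exact le_self_add
        _ ≤ δ := ENNReal.mul_div_le
    refine le_of_tendsto (ENNReal.tendsto_ofReal hquot) ?_
    rw [ENNReal.tendsto_nhds_zero] at hm0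
    obtain ⟨r, hr, hr'⟩ := Metric.eventually_nhds_iff.1 (hm0 ε hε)
    filter_upwards [Ioo_mem_nhdsGT hr] with h hh
    have h1 := hbound h hh.1 ε fun σ hσ => hr' (by
      rw [Real.dist_eq, sub_zero]
      exact hσ.trans_lt hh.2)
    rw [ENNReal.ofReal_mul (inv_nonneg.2 hh.1.le)]
    calc _ ≤ ENNReal.ofReal h⁻¹ * (ENNReal.ofReal h * (K * (N * ε))) := by gcongr
      _ = K * (N * ε) := by
        rw [← mul_assoc, ← ENNReal.ofReal_mul (inv_nonneg.2 hh.1.le), inv_mul_cancel₀ hh.1.ne',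
          ENNReal.ofReal_one, one_mul]
      _ ≤ δ := hεδ
  have := ENNReal.ofReal_eq_zero.1 (nonpos_iff_eq_zero.1 hlim)
  linarith

/-! ### Increments in time and the weak time derivative -/

/-- The primitive, vanishing at `-∞`, of the `n`-th mollifier on the line: a smooth approximation
of the Heaviside function. -/
noncomputable def smoothHeaviside (n : ℕ) (x : ℝ) : ℝ :=
  ∫ y in Iic x, (mollifierBump ℝ n).normed volume y

theorem mollifierBump_normed_eq_zero {n : ℕ} {x : ℝ} (hx : (mollifierBump ℝ n).rOut ≤ |x|) :
    (mollifierBump ℝ n).normed volume x = 0 := by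
  have : x ∉ Function.support ((mollifierBump ℝ n).normed volume) := by
    rw [ContDiffBump.support_normed_eq, mem_ball_zero_iff, Real.norm_eq_abs, not_lt]
    exact hx
  exact Function.notMem_support.1 this

theorem hasDerivAt_smoothHeaviside (n : ℕ) (x : ℝ) :
    HasDerivAt (smoothHeaviside n) ((mollifierBump ℝ n).normed volume x) x := by
  have hc : Continuous ((mollifierBump ℝ n).normed volume) := (mollifierBump ℝ n).continuous_normed
  have hi : Integrable ((mollifierBump ℝ n).normed volume) := (mollifierBump ℝ n).integrable_normed
  have h := (intervalIntegral.integral_hasDerivAt_right (hc.intervalIntegrable 0 x)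
    (hc.stronglyMeasurableAtFilter _ _) hc.continuousAt).const_add (smoothHeaviside n 0)
  refine h.congr_of_eventuallyEq (.of_forall fun y => ?_)
  simp only [smoothHeaviside]
  rw [← intervalIntegral.integral_Iic_sub_Iic hi.integrableOn hi.integrableOn]
  ring

theorem contDiff_smoothHeaviside (n : ℕ) : ContDiff ℝ ∞ (smoothHeaviside n) := by
  have hd : deriv (smoothHeaviside n) = (mollifierBump ℝ n).normed volume :=
    funext fun x => (hasDerivAt_smoothHeaviside n x).deriv
  refine contDiff_infty_iff_deriv.2 ⟨fun x => (hasDerivAt_smoothHeaviside n x).differentiableAt, ?_⟩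
  rw [hd]
  exact (mollifierBump ℝ n).contDiff_normed

theorem smoothHeaviside_of_le {n : ℕ} {x : ℝ} (hx : x ≤ -(mollifierBump ℝ n).rOut) :
    smoothHeaviside n x = 0 := by
  refine setIntegral_eq_zero_of_forall_eq_zero fun y hy => mollifierBump_normed_eq_zero ?_
  have := mem_Iic.1 hy
  exact le_abs.2 (Or.inr (by linarith))

theorem smoothHeaviside_of_ge {n : ℕ} {x : ℝ} (hx : (mollifierBump ℝ n).rOut ≤ x) :
    smoothHeaviside n x = 1 := by
  rw [smoothHeaviside, setIntegral_eq_integral_of_forall_compl_eq_zero,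
    (mollifierBump ℝ n).integral_normed]
  intro y hy
  have : x < y := by simpa using hy
  exact mollifierBump_normed_eq_zero (le_abs.2 (Or.inl (by linarith)))

theorem smoothHeaviside_nonneg (n : ℕ) (x : ℝ) : 0 ≤ smoothHeaviside n x :=
  integral_nonneg fun _ => (mollifierBump ℝ n).nonneg_normed _

theorem smoothHeaviside_le_one (n : ℕ) (x : ℝ) : smoothHeaviside n x ≤ 1 := by
  rw [← (mollifierBump ℝ n).integral_normed (μ := (volume : Measure ℝ))]
  exact setIntegral_le_integral (mollifierBump ℝ n).integrable_normed
    (.of_forall fun _ => (mollifierBump ℝ n).nonneg_normed _)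

theorem eventually_smoothHeaviside_eq_zero {x : ℝ} (hx : x < 0) :
    ∀ᶠ n in atTop, smoothHeaviside n x = 0 := by
  filter_upwards [(tendsto_order.1 (tendsto_mollifierBump_rOut ℝ)).2 (-x) (by linarith)] with n hn
  exact smoothHeaviside_of_le (by linarith)

theorem eventually_smoothHeaviside_eq_one {x : ℝ} (hx : 0 < x) :
    ∀ᶠ n in atTop, smoothHeaviside n x = 1 := by
  filter_upwards [(tendsto_order.1 (tendsto_mollifierBump_rOut ℝ)).2 x hx] with n hn
  exact smoothHeaviside_of_ge hn.le

theorem Ioi_zero_eq_iUnion_Ioo : Ioi (0 : ℝ) = ⋃ k : ℕ, Ioo (0 : ℝ) (k + 1) := by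
  ext t
  simp only [mem_Ioi, mem_iUnion, mem_Ioo]
  refine ⟨fun ht => ?_, fun ⟨_, ht⟩ => ht.1⟩
  obtain ⟨k, hk⟩ := exists_nat_gt t
  exact ⟨k, ht, by linarith⟩

section TimeDerivative

variable {d : ℕ} {Ω : Set (E d)}

theorem integral_fn_mul_eq_innerSL (f : L2 Ω) (φ : H1 Ω) :
    ∫ x in Ω, f x * φ.fn x = innerSL ℝ φ.fn f := by
  rw [innerSL_apply_apply, L2.inner_def]
  simp

/-- The evaluation of functionals on `H¹(Ω)` at `φ`. -/
noncomputable def H1dual.evalL (φ : H1 Ω) : H1dual Ω →L[ℝ] ℝ :=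
  show StrongDual ℝ (H1 Ω) →L[ℝ] ℝ from ContinuousLinearMap.apply ℝ ℝ φ

/-- The mollification of `t ↦ C(t)`, tested against `φ`. -/
theorem innerSL_convolution_eq {f : ℝ → L2 Ω} (hf : LocallyIntegrable f volume) (φ : H1 Ω) (n : ℕ)
    (a : ℝ) :
    innerSL ℝ φ.fn
        (((mollifierBump ℝ n).normed volume ⋆[ContinuousLinearMap.lsmul ℝ ℝ, volume] f) a) =
      ∫ t, (mollifierBump ℝ n).normed volume (t - a) * innerSL ℝ φ.fn (f t) := by
  have hr : ∀ t, (mollifierBump ℝ n).normed volume (a - t) =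
      (mollifierBump ℝ n).normed volume (t - a) := fun t => by
    rw [← neg_sub, ContDiffBump.normed_neg]
  have hc : Continuous fun t => (mollifierBump ℝ n).normed volume (a - t) :=
    (mollifierBump ℝ n).continuous_normed.comp (continuous_const.sub continuous_id)
  have hs : HasCompactSupport fun t => (mollifierBump ℝ n).normed volume (a - t) :=
    (mollifierBump ℝ n).hasCompactSupport_normed.comp_homeomorph (Homeomorph.subLeft a)
  have hi : Integrable fun t => (mollifierBump ℝ n).normed volume (a - t) • f t :=
    hf.integrable_smul_left_of_hasCompactSupport hc hs
  rw [convolution_eq_swap]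
  simp only [ContinuousLinearMap.lsmul_apply]
  rw [← ContinuousLinearMap.integral_comp_comm _ hi]
  simp only [map_smul, smul_eq_mul, hr]

/-- Off a null set of times `C(b) - C(a) = ∫ W` in `(H¹(Ω))*`; the exceptional set does not depend
on the test function. -/
theorem HasWeakTimeDeriv.exists_sub_eq_integral {C : ℝ → H1 Ω} {W : ℝ → H1dual Ω}
    (h : HasWeakTimeDeriv C W) (hC : MemLp C 2 (volume.restrict (Ioi (0 : ℝ))))
    (hW : ∀ T : ℝ, 0 < T → IntegrableOn W (Ioo 0 T)) :
    ∃ G : Set ℝ, (∀ᵐ t, 0 < t → t ∈ G) ∧ ∀ a ∈ G, 0 < a → ∀ b ∈ G, a < b → ∀ φ : H1 Ω,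
      IntegrableOn (fun τ => (W τ).pair φ) (Ioc a b) ∧
      ∫ x in Ω, ((C b).fn x - (C a).fn x) * φ.fn x = ∫ τ in Ioc a b, (W τ).pair φ := by
  -- The good times are the Lebesgue points of `C` as an `L²(Ω)`-valued function. The test functions
  -- in time are smooth approximations `η n` of the indicator function of `(a, b)`.
  set f : ℝ → L2 Ω := (Ioi (0 : ℝ)).indicator fun t => (C t).fn with hf
  have hf2 : MemLp f 2 volume :=
    (memLp_indicator_iff_restrict measurableSet_Ioi).2 ((H1.fnL Ω).comp_memLp' hC)
  have hfl : LocallyIntegrable f volume := hf2.locallyIntegrable one_le_two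
  have hlim := ContDiffBump.ae_convolution_tendsto_right_of_locallyIntegrable (K := 2)
    (tendsto_mollifierBump_rOut ℝ) (.of_forall fun n => (mollifierBump_rOut n).le) hfl
  refine ⟨_, hlim.mono fun t ht _ => ht, fun a ha ha0 b hb hab φ => ?_⟩
  have hb0 : 0 < b := ha0.trans hab
  set w : ℝ → ℝ := fun τ => (W τ).pair φ with hw
  have hwi : ∀ T : ℝ, 0 < T → IntegrableOn w (Ioo 0 T) := fun T hT =>
    (H1dual.evalL φ).integrable_comp (hW T hT)
  have hwab : IntegrableOn w (Ioc a b) :=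
    (hwi (b + 1) (by linarith)).mono_set fun t ht => ⟨ha0.trans ht.1, by linarith [ht.2]⟩
  refine ⟨hwab, ?_⟩
  let r : ℕ → ℝ → ℝ := fun n => (mollifierBump ℝ n).normed volume
  let η : ℕ → ℝ → ℝ := fun n t => smoothHeaviside n (t - a) - smoothHeaviside n (t - b)
  let ℓ := innerSL ℝ φ.fn
  have hηd : ∀ n t, HasDerivAt (η n) (r n (t - a) - r n (t - b)) t := fun n t =>
    ((hasDerivAt_smoothHeaviside n (t - a)).comp_sub_const t a).sub
      ((hasDerivAt_smoothHeaviside n (t - b)).comp_sub_const t b)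
  have hηs : ∀ n, ContDiff ℝ ∞ (η n) := fun n =>
    ((contDiff_smoothHeaviside n).comp (contDiff_id.sub contDiff_const)).sub
      ((contDiff_smoothHeaviside n).comp (contDiff_id.sub contDiff_const))
  have hη0 : ∀ n t, t ∉ Icc (a - (mollifierBump ℝ n).rOut) (b + (mollifierBump ℝ n).rOut) →
      η n t = 0 := by
    intro n t ht
    have hpos := (mollifierBump ℝ n).rOut_pos
    simp only [η]
    rcases lt_or_ge t (a - (mollifierBump ℝ n).rOut) with h1 | h1
    · rw [smoothHeaviside_of_le (by linarith), smoothHeaviside_of_le (by linarith), sub_zero]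
    · have h2 : b + (mollifierBump ℝ n).rOut < t := by
        by_contra h3
        exact ht ⟨h1, not_lt.1 h3⟩
      rw [smoothHeaviside_of_ge (by linarith), smoothHeaviside_of_ge (by linarith), sub_self]
  have hηts : ∀ n, tsupport (η n) ⊆
      Icc (a - (mollifierBump ℝ n).rOut) (b + (mollifierBump ℝ n).rOut) := fun n =>
    closure_minimal (fun t ht => by
      by_contra h1
      exact ht (hη0 n t h1)) isClosed_Icc
  have hη1 : ∀ n t, |η n t| ≤ 1 := fun n t => abs_le.2
    ⟨by linarith [smoothHeaviside_nonneg n (t - a), smoothHeaviside_le_one n (t - b)],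
      by linarith [smoothHeaviside_nonneg n (t - b), smoothHeaviside_le_one n (t - a)]⟩
  have hri : ∀ n c, Integrable fun t => r n (t - c) * ℓ (f t) := fun n c => by
    have hc : Continuous fun t => r n (t - c) :=
      (mollifierBump ℝ n).continuous_normed.comp (continuous_id.sub continuous_const)
    have hs : HasCompactSupport fun t => r n (t - c) :=
      (mollifierBump ℝ n).hasCompactSupport_normed.comp_homeomorph (Homeomorph.subRight c)
    have := ℓ.integrable_comp (hfl.integrable_smul_left_of_hasCompactSupport hc hs)
    simpa only [map_smul, smul_eq_mul] using this
  have heq : ∀ᶠ n in atTop, ℓ ((r n ⋆[ContinuousLinearMap.lsmul ℝ ℝ, volume] f) b) -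
      ℓ ((r n ⋆[ContinuousLinearMap.lsmul ℝ ℝ, volume] f) a) = ∫ t in Ioi 0, η n t * w t := by
    filter_upwards [(tendsto_order.1 (tendsto_mollifierBump_rOut ℝ)).2 a ha0] with n hn
    have h1 := h (η n) (hηs n)
      (HasCompactSupport.of_support_subset_isCompact isCompact_Icc
        ((subset_tsupport _).trans (hηts n)))
      ((hηts n).trans fun t ht => by
        have := ht.1
        rw [mem_Ioi]
        linarith) φ
    have h2 : ∫ t in Ioi (0 : ℝ), deriv (η n) t * ∫ x in Ω, (C t).fn x * φ.fn x =
        ∫ t, (r n (t - a) * ℓ (f t) - r n (t - b) * ℓ (f t)) := by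
      rw [← integral_indicator measurableSet_Ioi]
      refine integral_congr_ae (.of_forall fun t => ?_)
      by_cases ht : t ∈ Ioi (0 : ℝ)
      · simp only [indicator_of_mem ht, hf, integral_fn_mul_eq_innerSL, (hηd n t).deriv]
        ring
      · simp only [indicator_of_notMem ht, hf, map_zero, mul_zero, sub_zero]
    rw [h2, integral_sub (hri n a) (hri n b)] at h1
    simp only [ℓ, r] at h1 ⊢
    rw [innerSL_convolution_eq hfl, innerSL_convolution_eq hfl]
    linarith
  have hL : Tendsto (fun n => ℓ ((r n ⋆[ContinuousLinearMap.lsmul ℝ ℝ, volume] f) b) -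
      ℓ ((r n ⋆[ContinuousLinearMap.lsmul ℝ ℝ, volume] f) a)) atTop (𝓝 (ℓ (f b) - ℓ (f a))) :=
    ((ℓ.continuous.tendsto _).comp hb).sub ((ℓ.continuous.tendsto _).comp ha)
  have hR : Tendsto (fun n => ∫ t in Ioi 0, η n t * w t) atTop
      (𝓝 (∫ t in Ioi 0, (Ioc a b).indicator w t)) := by
    have hwi2 : IntegrableOn ((Ioo 0 (b + 2)).indicator fun t => |w t|) (Ioi 0) :=
      ((integrable_indicator_iff measurableSet_Ioo).2 (hwi (b + 2) (by linarith)).abs).integrableOn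
    have hbd : ∀ n t, 0 < t → |η n t * w t| ≤ (Ioo 0 (b + 2)).indicator (fun t => |w t|) t := by
      intro n t ht
      by_cases htb : t < b + 2
      · rw [indicator_of_mem (mem_Ioo.2 ⟨ht, htb⟩), abs_mul]
        exact mul_le_of_le_one_left (abs_nonneg _) (hη1 n t)
      · rw [hη0 n t, zero_mul, abs_zero]
        · exact indicator_nonneg (fun _ _ => abs_nonneg _) _
        · intro h1
          have h2 : (mollifierBump ℝ n).rOut ≤ 1 := by
            simp only [mollifierBump]
            rw [div_le_one (by positivity)]
            linarith [(n.cast_nonneg : (0 : ℝ) ≤ n)]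
          linarith [h1.2]
    have hwm : ∀ n, AEStronglyMeasurable (fun t => η n t * w t) (volume.restrict (Ioi 0)) := by
      intro n
      refine (hηs n).continuous.aestronglyMeasurable.mul ?_
      rw [Ioi_zero_eq_iUnion_Ioo, aestronglyMeasurable_iUnion_iff]
      exact fun k => (hwi (k + 1) (by positivity)).aestronglyMeasurable
    refine tendsto_integral_of_dominated_convergence _ hwm hwi2
      (fun n => (ae_restrict_iff' measurableSet_Ioi).2 (.of_forall fun t ht => hbd n t ht)) ?_
    have hna : ∀ᵐ t ∂(volume.restrict (Ioi (0 : ℝ))), t ≠ a :=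
      ae_restrict_of_ae (Measure.ae_ne volume a)
    have hnb : ∀ᵐ t ∂(volume.restrict (Ioi (0 : ℝ))), t ≠ b :=
      ae_restrict_of_ae (Measure.ae_ne volume b)
    filter_upwards [hna, hnb] with t hta htb
    refine tendsto_const_nhds.congr' ?_
    rcases lt_or_gt_of_ne hta with h1 | h1
    · filter_upwards [eventually_smoothHeaviside_eq_zero (sub_neg.2 h1),
        eventually_smoothHeaviside_eq_zero (sub_neg.2 (h1.trans hab))] with n h2 h3
      rw [indicator_of_notMem fun h4 => h1.not_gt h4.1]
      simp [η, h2, h3]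
    · rcases lt_or_gt_of_ne htb with h5 | h5
      · filter_upwards [eventually_smoothHeaviside_eq_one (sub_pos.2 h1),
          eventually_smoothHeaviside_eq_zero (sub_neg.2 h5)] with n h2 h3
        rw [indicator_of_mem (mem_Ioc.2 ⟨h1, h5.le⟩)]
        simp [η, h2, h3]
      · filter_upwards [eventually_smoothHeaviside_eq_one (sub_pos.2 h1),
          eventually_smoothHeaviside_eq_one (sub_pos.2 h5)] with n h2 h3
        rw [indicator_of_notMem fun h4 => h5.not_ge h4.2]
        simp [η, h2, h3]
  have hfin := tendsto_nhds_unique (hL.congr' heq) hR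
  have hsub : Ioc a b ⊆ Ioi 0 := fun t ht => ha0.trans ht.1
  rw [setIntegral_indicator measurableSet_Ioc, inter_eq_right.2 hsub] at hfin
  rw [← hfin]
  simp only [hf, indicator_of_mem (mem_Ioi.2 ha0), indicator_of_mem (mem_Ioi.2 hb0), ℓ]
  rw [← map_sub, ← integral_fn_mul_eq_innerSL]
  refine integral_congr_ae ?_
  filter_upwards [Lp.coeFn_sub (C b).fn (C a).fn] with x hx
  rw [hx, Pi.sub_apply]

end TimeDerivative

/-! ### Decay of the energy outside an interval -/

theorem one_le_timeExponent (d : ℕ) : 1 ≤ timeExponent d := by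
  unfold timeExponent
  split_ifs
  · exact one_le_two
  · rw [ENNReal.le_div_iff_mul_le (by simp) (by simp)]
    norm_num

/-- The filter of the initial condition is nontrivial, so that the condition is not vacuous. -/
theorem neBot_nhdsGT_inf_ae : (𝓝[>] (0 : ℝ) ⊓ ae volume).NeBot := by
  rw [inf_neBot_iff]
  intro s hs t ht
  obtain ⟨δ, hδ, hsub⟩ := mem_nhdsGT_iff_exists_Ioo_subset.1 hs
  have h0 : volume (Ioo (0 : ℝ) δ ∩ t) ≠ 0 := by
    rw [measure_inter_conull ht, Real.volume_Ioo, sub_zero]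
    simpa using hδ
  exact (nonempty_of_measure_ne_zero h0).mono (inter_subset_inter_left _ hsub)

section Energy

variable {d : ℕ} {Ω : Set (E d)} {M : ℝ} {b B : ℝ → ℝ}

theorem IsPenalty.integrable_comp (h : IsPenalty M b B) (hM : 0 ≤ M) [IsFiniteMeasure (vol Ω)]
    (f : L2 Ω) : Integrable (fun x => B (f x)) (vol Ω) := by
  refine ((Lp.memLp f).integrable one_le_two).mono
    (h.continuous.comp_aestronglyMeasurable (Lp.aestronglyMeasurable f)) (.of_forall fun x => ?_)
  simpa [h.eq_zero 0 le_rfl hM] using h.abs_sub_le (f x) 0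

theorem IsPenalty.lipschitz_integral (h : IsPenalty M b B) (hM : 0 ≤ M) [IsFiniteMeasure (vol Ω)] :
    ∃ K : ℝ, ∀ f g : L2 Ω, |(∫ x in Ω, B (f x)) - ∫ x in Ω, B (g x)| ≤ K * ‖f - g‖ := by
  have h1 : MemLp (fun _ : E d => (1 : ℝ)) 2 (vol Ω) := memLp_const 1
  refine ⟨‖h1.toLp _‖, fun f g => ?_⟩
  rw [← integral_sub (h.integrable_comp hM f) (h.integrable_comp hM g), mul_comm]
  have := abs_integral_le_of_ae_le_norm_mul_norm (f - g) (h1.toLp _) zero_le_one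
    (F := fun x => B (f x) - B (g x)) (by
      filter_upwards [Lp.coeFn_sub f g, h1.coeFn_toLp] with x hx hx'
      rw [hx, hx', norm_one, mul_one, one_mul]
      exact h.abs_sub_le _ _)
  rwa [one_mul] at this

theorem lintegral_enorm_rpow_two_ne_top_of_memLp {X : Type*} [NormedAddCommGroup X] {f : ℝ → X}
    (hf : MemLp f 2 volume) : ∫⁻ t, ‖f t‖ₑ ^ (2 : ℝ) ≠ ⊤ := by
  have := (eLpNorm_lt_top_iff_lintegral_rpow_enorm_lt_top (by norm_num) (by norm_num)).1 hf.2
  simpa using this.ne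

/-- The energy `t ↦ ∫ B(c(t))` of the values outside `[0, M]` is nonincreasing off a null set and
tends to zero at the initial time, so it vanishes. -/
theorem IsWeakSolutionWith.ae_penalty_eq_zero {P : Medium d} {s : ℝ} (hs : |s| ≤ 1) {m : ℝ → ℝ}
    {c₀ : E d → ℝ} {c : ℝ → E d → ℝ} {u : ℝ → L2vec P.Ω} {C : ℝ → H1 P.Ω} {W : ℝ → H1dual P.Ω}
    (h : IsWeakSolutionWith P s m c₀ c u C W) (hb : IsPenalty M b B) (hM : 0 ≤ M)
    (hc₀_meas : AEStronglyMeasurable c₀ (vol P.Ω))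
    (hc₀ : ∀ᵐ x ∂(vol P.Ω), 0 ≤ c₀ x ∧ c₀ x ≤ M) :
    ∀ᵐ t ∂(volume.restrict (Ioi (0 : ℝ))), ∀ᵐ x ∂(vol P.Ω), B (c t x) = 0 := by
  have hfin := P.domain.isFiniteMeasure
  obtain ⟨Kκ, hKκ, hκ⟩ := P.exists_bound_κ
  obtain ⟨KE, hKE⟩ := hb.lipschitz_integral (Ω := P.Ω) hM
  obtain ⟨G, hG, hGW⟩ := h.deriv_eq.exists_sub_eq_integral h.c_mem fun T hT =>
    (h.deriv_mem T hT).integrable (one_le_timeExponent d)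
  set Ct : ℝ → H1 P.Ω := (Ioi (0 : ℝ)).indicator C with hCt
  set ut : ℝ → L2vec P.Ω := (Ioi (0 : ℝ)).indicator u with hut
  have hCt2 : MemLp Ct 2 volume := (memLp_indicator_iff_restrict measurableSet_Ioi).2 h.c_mem
  have hut2 : MemLp ut 2 volume := (memLp_indicator_iff_restrict measurableSet_Ioi).2 h.u_mem
  -- the energy of the values outside `[0, M]`
  set energy : L2 P.Ω → ℝ := fun f => ∫ x in P.Ω, B (f x) with henergy
  have hcont : Continuous energy := by
    refine (LipschitzWith.of_dist_le_mul (K := KE.toNNReal) fun f g => ?_).continuous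
    rw [Real.dist_eq, dist_eq_norm]
    exact (hKE f g).trans (by gcongr; exact Real.le_coe_toNNReal KE)
  have henergy0 : energy 0 = 0 := by
    refine integral_eq_zero_of_ae ?_
    filter_upwards [Lp.coeFn_zero ℝ 2 (vol P.Ω)] with x hx
    rw [hx, Pi.zero_apply, hb.eq_zero 0 le_rfl hM]
  set e : ℝ → ℝ := fun t => energy (Ct t).fn with he
  have hel : LocallyIntegrable e volume := by
    have hfn : MemLp (fun t => (Ct t).fn) 2 volume := (H1.fnL P.Ω).comp_memLp' hCt2
    have he2 : MemLp e 2 volume := by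
      refine MemLp.of_le_mul (c := KE) hfn (hcont.comp_aestronglyMeasurable hfn.1)
        (.of_forall fun t => ?_)
      have := hKE (Ct t).fn 0
      simp only [henergy] at henergy0
      rwa [henergy0, sub_zero, sub_zero] at this
    exact he2.locallyIntegrable one_le_two
  have hgood : ∀ᵐ τ, 0 < τ → u τ ∈ solenoidal P.Ω ∧
      (∀ᵐ x ∂(vol P.Ω), (C τ).fn x = c τ x) ∧ MemLp (fun x => c τ x • u τ x) 2 (vol P.Ω) ∧
      ∀ φ : H1 P.Ω, (1 + P.k) * (W τ).pair φ + s * (∫ x in P.Ω, ⟪c τ x • u τ x, φ.grad x⟫) +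
        P.D * (∫ x in P.Ω, ⟪(C τ).grad x, φ.grad x⟫) +
        ∫ x in P.Ω, P.κ x * c τ x * φ.fn x = 0 := by
    refine (ae_restrict_iff' measurableSet_Ioi).1 ?_
    filter_upwards [h.u_sol, h.repr, h.flux_mem, h.transport] with τ h1 h2 h3 h4
    exact ⟨h1, h2, h3, h4⟩
  have hD := P.D_pos
  set A : ℝ := 1 + 2 * P.D + 2 * Kκ with hA
  have hA0 : 0 ≤ A := by positivity
  have hinc : ∀ a ∈ G ∩ Ioi 0, ∀ b' ∈ G ∩ Ioi 0, a < b' → ENNReal.ofReal (e b' - e a) ≤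
      ENNReal.ofReal A * ∫⁻ τ in Ioc a b', (‖ut τ‖ₑ + ‖Ct b'‖ₑ) * ‖Ct τ - Ct b'‖ₑ := by
    rintro a ⟨haG, ha0⟩ t ⟨htG, ht0⟩ hat
    obtain ⟨χ, hχ, hχ'⟩ := H1.exists_comp P.domain.1 (C t) hb.contDiff hb.abs_deriv_le
    obtain ⟨hWi, hWeq⟩ := hGW a haG ha0 t htG hat χ
    -- tangent inequality at time `t`, then the time derivative tested with `χ = b(c(t))`
    have e1 : e t - e a ≤ ∫ τ in Ioc a t, (W τ).pair χ := by
      rw [← hWeq]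
      simp only [he, hCt, indicator_of_mem ha0, indicator_of_mem ht0, henergy]
      rw [← integral_sub (hb.integrable_comp hM _) (hb.integrable_comp hM _)]
      refine integral_mono_ae ((hb.integrable_comp hM _).sub (hb.integrable_comp hM _)) ?_ ?_
      · exact MemLp.integrable_mul (p := 2) (q := 2)
          ((Lp.memLp (C t).fn).sub (Lp.memLp (C a).fn)) (Lp.memLp χ.fn)
      · filter_upwards [hχ] with x hx
        rw [hx, mul_comm]
        exact hb.sub_le _ _
    refine (ENNReal.ofReal_le_ofReal e1).trans
      ((ofReal_integral_le_lintegral_ofReal hWi).trans ?_)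
    rw [← lintegral_const_mul' _ _ ENNReal.ofReal_ne_top]
    refine lintegral_mono_ae ((ae_restrict_iff' measurableSet_Ioc).2 ?_)
    filter_upwards [hgood] with τ hτ hτm
    have hτ0 : τ ∈ Ioi (0 : ℝ) := lt_trans ha0 hτm.1
    obtain ⟨h1, h2, h3, h4⟩ := hτ hτ0
    have h5 := pair_penalty_le P hs hb hKκ hκ h1 h2 h3 h4 hχ hχ'
    refine (ENNReal.ofReal_le_ofReal h5).trans (le_of_eq ?_)
    simp only [hCt, hut, indicator_of_mem hτ0, indicator_of_mem ht0]
    rw [ENNReal.ofReal_mul hA0, ENNReal.ofReal_mul (by positivity),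
      ENNReal.ofReal_add (norm_nonneg _) (norm_nonneg _), ofReal_norm, ofReal_norm, ofReal_norm]
  have hG0 : ∀ᵐ t, 0 < t → t ∈ G ∩ Ioi 0 := by
    filter_upwards [hG] with t ht ht0
    exact ⟨ht ht0, ht0⟩
  obtain ⟨G', -, hG', hmono⟩ := le_of_increment_le_lintegral hCt2 hut2.1.enorm hCt2.1.enorm
    (lintegral_enorm_rpow_two_ne_top_of_memLp hut2) (lintegral_enorm_rpow_two_ne_top_of_memLp hCt2)
    hel ENNReal.ofReal_ne_top hG0 hinc
  rw [ae_restrict_iff' measurableSet_Ioi]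
  filter_upwards [hG', hgood] with t htG htgood ht0
  have hrepr := (htgood ht0).2.1
  -- the energy tends to zero at the initial time
  have hle : ENNReal.ofReal (e t) ≤ 0 := by
    have hinit : Tendsto (fun τ => eLpNorm (c τ - c₀) 2 (vol P.Ω) *
        vol P.Ω univ ^ (1 / (1 : ℝ≥0∞).toReal - 1 / (2 : ℝ≥0∞).toReal))
        (𝓝[>] 0 ⊓ ae volume) (𝓝 0) := by
      have := ENNReal.Tendsto.mul_const (b := vol P.Ω univ ^
        (1 / (1 : ℝ≥0∞).toReal - 1 / (2 : ℝ≥0∞).toReal)) h.initial (Or.inr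
        (ENNReal.rpow_ne_top_of_nonneg (by norm_num) (measure_ne_top _ _)))
      rwa [zero_mul] at this
    have := neBot_nhdsGT_inf_ae
    refine ge_of_tendsto hinit ?_
    filter_upwards [mem_inf_of_left (Ioo_mem_nhdsGT ht0),
      mem_inf_of_right (f := 𝓝[>] (0 : ℝ)) (hG'.and hgood)] with τ hτ hτ'
    obtain ⟨-, hr, -, -⟩ := hτ'.2 hτ.1
    have hτ0 : τ ∈ Ioi (0 : ℝ) := hτ.1
    have hm : AEStronglyMeasurable (c τ - c₀) (vol P.Ω) :=
      ((Lp.aestronglyMeasurable (C τ).fn).congr hr).sub hc₀_meas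
    refine le_trans ?_ (eLpNorm_le_eLpNorm_mul_rpow_measure_univ one_le_two hm)
    rw [eLpNorm_one_eq_lintegral_enorm]
    refine (ENNReal.ofReal_le_ofReal (hmono τ (hτ'.1 hτ.1) hτ.1 t (htG ht0) hτ.2)).trans ?_
    refine (ofReal_integral_le_lintegral_ofReal (hb.integrable_comp hM _)).trans ?_
    refine lintegral_mono_ae ?_
    simp only [hCt, indicator_of_mem hτ0]
    filter_upwards [hr, hc₀] with x hx hx0
    rw [hx, ← ofReal_norm]
    refine ENNReal.ofReal_le_ofReal ?_
    have := hb.abs_sub_le (c τ x) (c₀ x)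
    rw [hb.eq_zero _ hx0.1 hx0.2, sub_zero] at this
    exact (le_abs_self _).trans this
  have hle' : e t ≤ 0 := by simpa using hle
  have hzero : ∫ x in P.Ω, B ((C t).fn x) = 0 := by
    have : e t = ∫ x in P.Ω, B ((C t).fn x) := by
      simp only [he, hCt, henergy, indicator_of_mem ht0]
    rw [← this]
    refine le_antisymm hle' ?_
    rw [this]
    exact integral_nonneg fun x => hb.nonneg _
  rw [integral_eq_zero_iff_of_nonneg (fun x => hb.nonneg _) (hb.integrable_comp hM _)] at hzero
  filter_upwards [hzero, hrepr] with x hx hx'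
  rw [← hx']
  exact hx

end Energy

/-! ### Bounds on the space-time cylinder -/

theorem ae_cyl_mem_of_ae_ae_mem {d : ℕ} {Ω : Set (E d)} {c : ℝ → E d → ℝ}
    (hc : AEStronglyMeasurable (Function.uncurry c) (cyl Ω)) {S : Set ℝ} (hS : MeasurableSet S)
    (h : ∀ᵐ t ∂(volume.restrict (Ioi (0 : ℝ))), ∀ᵐ x ∂(vol Ω), c t x ∈ S) :
    ∀ᵐ z ∂(cyl Ω), c z.1 z.2 ∈ S := by
  have h1 : ∀ᵐ z ∂(cyl Ω), hc.mk _ z ∈ S := by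
    have hm : MeasurableSet {z | hc.mk _ z ∈ S} := hc.stronglyMeasurable_mk.measurable hS
    rw [Measure.ae_prod_iff_ae_ae hm]
    filter_upwards [h, Measure.ae_ae_of_ae_prod hc.ae_eq_mk] with t h2 h3
    filter_upwards [h2, h3] with x h4 h5
    rwa [← h5]
  filter_upwards [h1, hc.ae_eq_mk] with z h2 h3
  rw [← h3] at h2
  exact h2

theorem IsWeakSolutionWith.ae_mem_Icc {d : ℕ} {P : Medium d} {s : ℝ} (hs : |s| ≤ 1) {m : ℝ → ℝ}
    {c₀ : E d → ℝ} {c : ℝ → E d → ℝ} {u : ℝ → L2vec P.Ω} {C : ℝ → H1 P.Ω} {W : ℝ → H1dual P.Ω}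
    (h : IsWeakSolutionWith P s m c₀ c u C W) {M : ℝ}
    (hc₀_meas : AEStronglyMeasurable c₀ (vol P.Ω))
    (hc₀ : ∀ᵐ x ∂(vol P.Ω), 0 ≤ c₀ x ∧ c₀ x ≤ M) :
    ∀ᵐ z ∂(cyl P.Ω), c z.1 z.2 ∈ Icc 0 M := by
  -- `Ω` has positive measure, so the bounds on `c₀` hold at some point
  have hM : 0 ≤ M := by
    have hne : vol P.Ω ≠ 0 := by
      rw [Ne, Measure.restrict_eq_zero]
      exact (P.domain.1.measure_pos volume P.domain.2.1.nonempty).ne'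
    have : (ae (vol P.Ω)).NeBot := ae_neBot.2 hne
    obtain ⟨x, hx⟩ := hc₀.exists
    exact hx.1.trans hx.2
  refine ae_cyl_mem_of_ae_ae_mem h.meas measurableSet_Icc ?_
  filter_upwards [h.ae_penalty_eq_zero hs (isPenalty_lower M) hM hc₀_meas hc₀,
    h.ae_penalty_eq_zero hs (isPenalty_upper hM) hM hc₀_meas hc₀] with t h1 h2
  filter_upwards [h1, h2] with x h3 h4
  exact ⟨by linarith [nonpos_of_posPenalty_eq_zero h3],
    by linarith [nonpos_of_posPenalty_eq_zero h4]⟩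

theorem ae_cyl_mem_of_tendsto_eLpNorm {d : ℕ} {Ω : Set (E d)}
    {c : ℕ → ℝ → E d → ℝ} {c' : ℝ → E d → ℝ}
    (hc : ∀ n, AEStronglyMeasurable (Function.uncurry (c n)) (cyl Ω))
    (hc' : AEStronglyMeasurable (Function.uncurry c') (cyl Ω)) {S : Set ℝ} (hS : IsClosed S)
    (hmem : ∀ n, ∀ᵐ z ∂(cyl Ω), c n z.1 z.2 ∈ S)
    (hlim : ∀ T : ℝ, 0 < T → Tendsto (fun n =>
      eLpNorm (Function.uncurry (c n) - Function.uncurry c') 2 (cylT T Ω)) atTop (𝓝 0)) :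
    ∀ᵐ z ∂(cyl Ω), c' z.1 z.2 ∈ S := by
  have hcyl : cyl Ω = (volume.prod volume).restrict (⋃ k : ℕ, Ioo (0 : ℝ) (k + 1) ×ˢ Ω) := by
    rw [cyl, vol, Measure.prod_restrict, Ioi_zero_eq_iUnion_Ioo, iUnion_prod_const]
  have hT : ∀ k : ℕ, ∀ᵐ z ∂(cylT (k + 1) Ω), c' z.1 z.2 ∈ S := by
    intro k
    have hle : cylT ((k : ℝ) + 1) Ω ≤ cyl Ω := by
      rw [cyl, cylT, vol, Measure.prod_restrict, Measure.prod_restrict]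
      exact Measure.restrict_mono (prod_mono Ioo_subset_Ioi_self subset_rfl) le_rfl
    have hac := Measure.absolutelyContinuous_of_le hle
    obtain ⟨ns, -, hns⟩ := (tendstoInMeasure_of_tendsto_eLpNorm two_ne_zero
      (fun n => (hc n).mono_measure hle) (hc'.mono_measure hle)
      (hlim (k + 1) (by positivity))).exists_seq_tendsto_ae
    have hall : ∀ᵐ z ∂(cylT ((k : ℝ) + 1) Ω), ∀ n, c n z.1 z.2 ∈ S :=
      ae_all_iff.2 fun n => hac.ae_le (hmem n)
    filter_upwards [hns, hall] with z h1 h2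
    exact hS.mem_of_tendsto h1 (.of_forall fun i => h2 (ns i))
  rw [hcyl, ae_restrict_iUnion_iff]
  intro k
  have := hT k
  rwa [cylT, vol, Measure.prod_restrict] at this

/-! ### Bounds on the truncated viscosity -/

theorem truncViscosity_mem_Icc {R ℓ s M : ℝ} (hR : 0 < R) (hℓ : 0 < ℓ) (hs : s ∈ Icc 0 M) :
    Real.exp (-(R * M)) ≤ truncViscosity R ℓ s ∧ truncViscosity R ℓ s ≤ Real.exp (R * M) := by
  have hM : 0 ≤ M := hs.1.trans hs.2
  have hRM : 0 ≤ R * M := by positivity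
  have hRs : 0 ≤ R * s := mul_nonneg hR.le hs.1
  have hRℓ : 0 ≤ R * ℓ := by positivity
  rw [truncViscosity]
  split_ifs with h1 h2
  · have : R * ℓ ≤ R * M := by gcongr; exact h1.le.trans hs.2
    exact ⟨Real.exp_le_exp.2 (by linarith), Real.exp_le_exp.2 this⟩
  · linarith [hs.1]
  · have : R * s ≤ R * M := by gcongr; exact hs.2
    exact ⟨Real.exp_le_exp.2 (by linarith), Real.exp_le_exp.2 this⟩

end DarcyTransport

theorem mainTheorem4 (d : ℕ) (hd : d = 2 ∨ d = 3) (P : DarcyTransport.Medium d)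
    (s : ℝ) (hs : s = 1 ∨ s = -1) (M₂ : ℝ) (c₀ : DarcyTransport.E d → ℝ)
    (hc₀_meas : AEStronglyMeasurable c₀ (DarcyTransport.vol P.Ω))
    (hc₀ : ∀ᵐ x ∂(DarcyTransport.vol P.Ω), 0 ≤ c₀ x ∧ c₀ x ≤ M₂) :
    -- the truncated problem: bounds on the concentration, and bounds on the viscosity free of `ℓ`
    (∀ ℓ : ℝ, 0 < ℓ → ∀ c u, DarcyTransport.IsTruncatedWeakSolution P s ℓ c₀ c u →
      (∀ᵐ z ∂(DarcyTransport.cyl P.Ω), 0 ≤ c z.1 z.2 ∧ c z.1 z.2 ≤ M₂) ∧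
      (∀ᵐ z ∂(DarcyTransport.cyl P.Ω),
        Real.exp (-(P.R * M₂)) ≤ DarcyTransport.truncViscosity P.R ℓ (c z.1 z.2) ∧
        DarcyTransport.truncViscosity P.R ℓ (c z.1 z.2) ≤ Real.exp (P.R * M₂))) ∧
    -- limits of solutions of truncated problems
    (∀ (ℓ : ℕ → ℝ) (c : ℕ → ℝ → DarcyTransport.E d → ℝ)
        (u : ℕ → ℝ → DarcyTransport.L2vec P.Ω) (c' : ℝ → DarcyTransport.E d → ℝ),
      (∀ n, 0 < ℓ n) → Tendsto ℓ atTop atTop →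
      (∀ n, DarcyTransport.IsTruncatedWeakSolution P s (ℓ n) c₀ (c n) (u n)) →
      AEStronglyMeasurable (Function.uncurry c') (DarcyTransport.cyl P.Ω) →
      (∀ T : ℝ, 0 < T →
        Tendsto (fun n => eLpNorm (Function.uncurry (c n) - Function.uncurry c') 2
          (DarcyTransport.cylT T P.Ω)) atTop (𝓝 0)) →
      ∀ᵐ z ∂(DarcyTransport.cyl P.Ω), 0 ≤ c' z.1 z.2 ∧ c' z.1 z.2 ≤ M₂) ∧
    -- weak solutions of the original problem
    (∀ c u, DarcyTransport.IsWeakSolution P s c₀ c u →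
      ∀ᵐ z ∂(DarcyTransport.cyl P.Ω), 0 ≤ c z.1 z.2 ∧ c z.1 z.2 ≤ M₂) := by
  have hs' : |s| ≤ 1 := by rcases hs with rfl | rfl <;> simp
  have htrunc : ∀ ℓ : ℝ, ∀ c u, DarcyTransport.IsTruncatedWeakSolution P s ℓ c₀ c u →
      ∀ᵐ z ∂(DarcyTransport.cyl P.Ω), c z.1 z.2 ∈ Icc 0 M₂ := by
    rintro ℓ c u ⟨-, C, W, h⟩
    exact h.ae_mem_Icc hs' hc₀_meas hc₀
  refine ⟨fun ℓ hℓ c u h => ⟨htrunc ℓ c u h, ?_⟩, ?_, ?_⟩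
  · filter_upwards [htrunc ℓ c u h] with z hz
    exact DarcyTransport.truncViscosity_mem_Icc P.R_pos hℓ hz
  · intro ℓ c u c' _ _ h hc' hlim
    refine DarcyTransport.ae_cyl_mem_of_tendsto_eLpNorm (S := Icc 0 M₂)
      (fun n => ?_) hc' isClosed_Icc
      (fun n => htrunc (ℓ n) (c n) (u n) (h n)) hlim
    obtain ⟨-, C, W, hn⟩ := h n
    exact hn.meas
  · rintro c u ⟨-, C, W, h⟩
    exact h.ae_mem_Icc hs' hc₀_meas hc₀
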